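/- Let $\Omega\subset\mathbb{R}^d$ ($d\ge 1$) be a bounded connected open set with Lipschitz boundary, and let $\delta_0\in(0,\infty)$. For $\delta\in(0,\delta_0]$ let $\Omega_I^\delta=\{y\notin\Omega:\ \|y-x\|<\delta\text{ for some }x\in\Omega\}$ and $\overline\Omega_\delta=\Omega\cup\Omega_I^\delta$, and let $\Omega_I^\delta=\Omega_{loc}^\delta\cup\Omega_{nloc}^\delta$ be a splitting into disjoint measurable sets. For each $\delta\in(0,\delta_0]$ let $\gamma_\delta:\mathbb{R}^d\times\mathbb{R}^d\to[0,\infty)$ be a measurable symmetric kernel such that, for $x\in\Omega$, $\gamma_\delta(x,y)>0$ if $\|x-y\|<\delta$ and $\gamma_\delta(x,y)=0$ if $\|x-y\|\ge\delta$, and such that there are $\gamma_1,\gamma_2>0$ (which may depend on $\delta$) with $\gamma_1\le\int_{\overline\Omega_\delta}\gamma_\delta(x,y)\,dy$ and $\int_{\overline\Omega_\delta}\gamma_\delta(x,y)^2\,dy\le\gamma_2^2$ for all $x\in\Omega$. Suppose that the kernels are properly scaled: uniformly in $x\in\Omega$, for all indices $i,j,k$, $$\int (y-x)_i\gamma_\delta(x,y)\,dy=O(\delta^2),\quad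 \int (y-x)_i(y-x)_j\gamma_\delta(x,y)\,dy=\delta_{ij}+O(\delta^2),\quad \int (y-x)_i(y-x)_j(y-x)_k\gamma_\delta(x,y)\,dy=O(\delta^2)$$ on $(0,\delta_0]$, where $\delta_{ij}$ is the Kronecker symbol (for radial kernels this holds, without error terms, if $\int\|z\|^2\gamma_\delta(0,z)\,dz=d$). Put $$\mathcal{L}_\delta u(x)=2\int_{\mathbb{R}^d}(u(y)-u(x))\gamma_\delta(x,y)\,dy,\qquad \mathcal{N}_\delta u(x)=-\int_{\overline\Omega_\delta}(u(y)-u(x))\gamma_\delta(x,y)\,dy,$$ $$|||v|||_\delta^2=\int_{\overline\Omega_\delta}\int_{\overline\Omega_\delta}(v(y)-v(x))^2\gamma_\delta(x,y)\,dy\,dx,\qquad V_\delta=\{v\in L^2(\overline\Omega_\delta):|||v|||_\delta<\infty\}.$$ For each $\delta\in(0,\delta_0]$ let $u_l=u_l^\delta$, continuous on the closure of $\overline\Omega_\delta$ and of class $C^4$ in $\overline\Omega_\delta$, solve the local problem $$-\Delta u_l=s\ \text{ in }\overline\Omega_\delta,\qquad u_l=w_l\ \text{ on }\partial\Omega_{loc}^\delta\cap\partial\overline\Omega_\delta,\qquad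 u_l=v_n\ \text{ on }\partial\Omega_{nloc}^\delta\cap\partial\overline\Omega_\delta,$$ where the data $s,w_l,v_n$ may depend on $\delta$. Suppose that the derivatives of $u_l^\delta$ of orders $0,\dots,4$ are bounded on $\overline\Omega_\delta$ uniformly in $\delta\in(0,\delta_0]$, and that the nonlocal data are compatible with the local solution: $v_n=u_l$ almost everywhere in $\Omega_{nloc}^\delta$. (a) (Dirichlet-to-Dirichlet strategy.) If $u_n=u_n^\delta\in V_\delta$ solves, almost everywhere, $$-\mathcal{L}_\delta u_n=s\ \text{ in }\Omega,\qquad u_n=u_l\ \text{ in }\Omega_{loc}^\delta,\qquad u_n=v_n\ \text{ in }\Omega_{nloc}^\delta,$$ then $|||u_n-u_l|||_\delta=O(\delta^2)$ as $\delta\to0^+$. (b) (Dirichlet-to-Neumann strategy.) Suppose in addition that, for each $\delta\in(0,\delta_0]$, $\int_{\overline\Omega_\delta}\gamma_\delta(x,y)^2\,dy$ is bounded over $x\in\Omega_{loc}^\delta$; that there are measurable $\rho_\delta:\mathbb{R}\to[0,\infty)$ with $\gamma_\delta(x,y)\ge\rho_\delta(\|y-x\|)$ for $x,y\in\overline\Omega_\delta$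 and $\inf_{0<\delta\le\delta_0}\int_{\|z\|<\delta}\|z\|^2\rho_\delta(\|z\|)\,dz>0$ (for properly scaled radial kernels take $\rho_\delta=\gamma_\delta$); and that there are $x_0\in\partial\Omega$ and $r>0$ such that every point of $\Omega_I^\delta$ at distance less than $r$ from $x_0$ belongs to $\Omega_{nloc}^\delta$, for all $\delta\in(0,\delta_0]$. If $u_n=u_n^\delta\in V_\delta$ solves, almost everywhere, $$-\mathcal{L}_\delta u_n=s\ \text{ in }\Omega,\qquad -\mathcal{N}_\delta u_n=-\mathcal{N}_\delta u_l\ \text{ in }\Omega_{loc}^\delta,\qquad u_n=v_n\ \text{ in }\Omega_{nloc}^\delta,$$ then $|||u_n-u_l|||_\delta=O(\delta^2)$ as $\delta\to0^+$. -/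

import Mathlib

open MeasureTheory Set Filter Topology
open scoped ENNReal

noncomputable section

namespace NonlocalPoisson

/-- The Euclidean space `ℝ^d`. -/
abbrev E (d : ℕ) : Type := EuclideanSpace ℝ (Fin d)

/-- Lipschitz boundary: near each boundary point, `Ω` is the strict epigraph, in some direction
`ν`, of a Lipschitz function of the component orthogonal to `ν`. -/
def HasLipschitzBoundary {d : ℕ} (Ω : Set (E d)) : Prop :=
  ∀ x₀ ∈ frontier Ω, ∃ r > 0, ∃ ν : E d, ‖ν‖ = 1 ∧ ∃ (K : NNReal) (g : E d → ℝ),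
    LipschitzWith K g ∧
      ∀ x ∈ Metric.ball x₀ r, x ∈ Ω ↔ g (x - inner ℝ ν x • ν) < inner ℝ ν x

/-- The interaction domain `Ω_I` of `Ω` with horizon `δ`. -/
def interactionDomain {d : ℕ} (Ω : Set (E d)) (δ : ℝ) : Set (E d) :=
  {y | y ∉ Ω ∧ ∃ x ∈ Ω, ‖y - x‖ < δ}

/-- The set `Ω ∪ Ω_I`. -/
def fullDomain {d : ℕ} (Ω : Set (E d)) (δ : ℝ) : Set (E d) :=
  Ω ∪ interactionDomain Ω δ

/-- A splitting of the interaction domain into two disjoint measurable parts. -/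
structure IsSplitting {d : ℕ} (Ω : Set (E d)) (δ : ℝ) (Ωloc Ωnloc : Set (E d)) : Prop where
  measurableSet_loc : MeasurableSet Ωloc
  measurableSet_nloc : MeasurableSet Ωnloc
  disjoint : Disjoint Ωloc Ωnloc
  union_eq : Ωloc ∪ Ωnloc = interactionDomain Ω δ

/-- The nonlocal Laplacian `2 ∫ (u(y) - u(x)) γ(x,y) dy`. -/
def nonlocalLaplacian {d : ℕ} (γ : E d → E d → ℝ) (u : E d → ℝ) (x : E d) : ℝ :=
  2 * ∫ y, (u y - u x) * γ x y

/-- The nonlocal flux `-∫_U (u(y) - u(x)) γ(x,y) dy`, used with `U = Ω ∪ Ω_I`. -/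
def nonlocalFlux {d : ℕ} (γ : E d → E d → ℝ) (U : Set (E d)) (u : E d → ℝ) (x : E d) : ℝ :=
  -∫ y in U, (u y - u x) * γ x y

/-- The nonlocal energy seminorm
`(∫_U ∫_U (v(y) - v(x))² γ(x,y) dy dx)^(1/2)`, with value in `[0, ∞]`. -/
def energySeminorm {d : ℕ} (γ : E d → E d → ℝ) (U : Set (E d)) (v : E d → ℝ) : ℝ≥0∞ :=
  (∫⁻ x in U, ∫⁻ y in U, ENNReal.ofReal ((v y - v x) ^ 2 * γ x y)) ^ (1 / 2 : ℝ)

/-- Membership in the nonlocal energy space `V(U)`. -/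
def MemEnergySpace {d : ℕ} (γ : E d → E d → ℝ) (U : Set (E d)) (v : E d → ℝ) : Prop :=
  MemLp v 2 (volume.restrict U) ∧ energySeminorm γ U v < ∞

/-- Nonnegative symmetric integrable kernels with horizon `δ` on `Ω`. The constants `γ₁`, `γ₂`
may depend on `δ`. -/
structure IsIntegrableKernel {d : ℕ} (Ω : Set (E d)) (δ : ℝ) (γ : E d → E d → ℝ) : Prop where
  measurable : Measurable (Function.uncurry γ)
  nonneg : ∀ x y, 0 ≤ γ x y
  symm : ∀ x y, γ x y = γ y x
  pos : ∀ x ∈ Ω, ∀ y, ‖x - y‖ < δ → 0 < γ x y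
  eq_zero : ∀ x ∈ Ω, ∀ y, δ ≤ ‖x - y‖ → γ x y = 0
  lower : ∃ γ₁ > 0, ∀ x ∈ Ω,
    ENNReal.ofReal γ₁ ≤ ∫⁻ y in fullDomain Ω δ, ENNReal.ofReal (γ x y)
  upper : ∃ γ₂ > 0, ∀ x ∈ Ω,
    ∫⁻ y in fullDomain Ω δ, ENNReal.ofReal (γ x y ^ 2) ≤ ENNReal.ofReal (γ₂ ^ 2)

/-- Proper scaling of a family of kernels: uniformly over `x ∈ Ω`, up to `O(δ²)`, the first and
third moments vanish and the matrix of second moments is the identity. For a radial kernel this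
holds, without error, as soon as `∫ |z|² γ = d`. -/
def ProperlyScaled {d : ℕ} (Ω : Set (E d)) (δ₀ : ℝ) (γ : ℝ → E d → E d → ℝ) : Prop :=
  ∃ K : ℝ, ∀ δ ∈ Ioc 0 δ₀, ∀ x ∈ Ω,
    (∀ i, |∫ y, (y - x) i * γ δ x y| ≤ K * δ ^ 2) ∧
    (∀ i j, |(∫ y, (y - x) i * (y - x) j * γ δ x y) - (if i = j then 1 else 0)| ≤ K * δ ^ 2) ∧
    (∀ i j k, |∫ y, (y - x) i * (y - x) j * (y - x) k * γ δ x y| ≤ K * δ ^ 2)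

/-- `u` is a classical solution of `-Δu = s` in `Ω ∪ Ω_I`, `u = w` on
`Γ_loc = ∂Ω_loc ∩ ∂(Ω ∪ Ω_I)`, `u = v` on `Γ_nloc = ∂Ω_nloc ∩ ∂(Ω ∪ Ω_I)`. The values of `v` on
`Γ_nloc`, which is disjoint from `Ω ∪ Ω_I`, are those of its trace. -/
structure IsLocalSolution {d : ℕ} (Ω : Set (E d)) (δ : ℝ) (Ωloc Ωnloc : Set (E d))
    (s w v u : E d → ℝ) : Prop where
  continuousOn : ContinuousOn u (closure (fullDomain Ω δ))
  contDiffOn : ContDiffOn ℝ 4 u (fullDomain Ω δ)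
  poisson : ∀ x ∈ fullDomain Ω δ, -(Laplacian.laplacian u x) = s x
  boundary_loc : ∀ x ∈ frontier Ωloc ∩ frontier (fullDomain Ω δ), u x = w x
  boundary_nloc : ∀ x ∈ frontier Ωnloc ∩ frontier (fullDomain Ω δ), u x = v x

/-- Bounds in `C⁴(Ω ∪ Ω_I)` for a family, uniform in `δ ∈ (0, δ₀]`. -/
def UniformlyC4 {d : ℕ} (Ω : Set (E d)) (δ₀ : ℝ) (u : ℝ → E d → ℝ) : Prop :=
  ∃ M : ℝ, ∀ δ ∈ Ioc 0 δ₀, ∀ k : ℕ, k ≤ 4 → ∀ x ∈ fullDomain Ω δ,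
    ‖iteratedFDeriv ℝ k (u δ) x‖ ≤ M

/-- `un` solves the nonlocal problem of the Dirichlet-to-Dirichlet strategy built on `ul`. -/
structure IsDtDSolution {d : ℕ} (Ω : Set (E d)) (δ : ℝ) (Ωloc Ωnloc : Set (E d))
    (γ : E d → E d → ℝ) (s v ul un : E d → ℝ) : Prop where
  mem : MemEnergySpace γ (fullDomain Ω δ) un
  poisson : ∀ᵐ x ∂volume.restrict Ω, -(nonlocalLaplacian γ un x) = s x
  eq_loc : ∀ᵐ x ∂volume.restrict Ωloc, un x = ul x
  eq_nloc : ∀ᵐ x ∂volume.restrict Ωnloc, un x = v x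

/-- `un` solves the nonlocal problem of the Dirichlet-to-Neumann strategy built on `ul`. -/
structure IsDtNSolution {d : ℕ} (Ω : Set (E d)) (δ : ℝ) (Ωloc Ωnloc : Set (E d))
    (γ : E d → E d → ℝ) (s v ul un : E d → ℝ) : Prop where
  mem : MemEnergySpace γ (fullDomain Ω δ) un
  poisson : ∀ᵐ x ∂volume.restrict Ω, -(nonlocalLaplacian γ un x) = s x
  flux_loc : ∀ᵐ x ∂volume.restrict Ωloc,
    -(nonlocalFlux γ (fullDomain Ω δ) un x) = -(nonlocalFlux γ (fullDomain Ω δ) ul x)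
  eq_nloc : ∀ᵐ x ∂volume.restrict Ωnloc, un x = v x

/-- Square integrability of the kernel at the points of `Ω_loc`, where a flux is prescribed. -/
def IntegrableAtLoc {d : ℕ} (Ω : Set (E d)) (δ : ℝ) (Ωloc : Set (E d))
    (γ : E d → E d → ℝ) : Prop :=
  ∃ γ₂ > 0, ∀ x ∈ Ωloc,
    ∫⁻ y in fullDomain Ω δ, ENNReal.ofReal (γ x y ^ 2) ≤ ENNReal.ofReal (γ₂ ^ 2)

/-- The kernels dominate, on `Ω ∪ Ω_I`, radial kernels `ρ δ` whose second moments over the ball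
of radius `δ` are bounded below uniformly in `δ`. For a family of radial, properly scaled kernels
one takes `ρ = γ`. -/
def DominatesRadial {d : ℕ} (Ω : Set (E d)) (δ₀ : ℝ) (γ : ℝ → E d → E d → ℝ) : Prop :=
  ∃ m > 0, ∃ ρ : ℝ → ℝ → ℝ, ∀ δ ∈ Ioc 0 δ₀,
    Measurable (ρ δ) ∧ (∀ t, 0 ≤ ρ δ t) ∧
    (∀ x ∈ fullDomain Ω δ, ∀ y ∈ fullDomain Ω δ, ρ δ ‖y - x‖ ≤ γ δ x y) ∧
    ENNReal.ofReal m ≤ ∫⁻ z in Metric.ball (0 : E d) δ, ENNReal.ofReal (‖z‖ ^ 2 * ρ δ ‖z‖)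

/-- Near some fixed boundary point of `Ω` the whole interaction layer belongs to `Ω_nloc`, for
every horizon. -/
def ContainsBoundaryPortion {d : ℕ} (Ω : Set (E d)) (δ₀ : ℝ) (Ωnloc : ℝ → Set (E d)) : Prop :=
  ∃ x₀ ∈ frontier Ω, ∃ r > 0, ∀ δ ∈ Ioc 0 δ₀,
    interactionDomain Ω δ ∩ Metric.ball x₀ r ⊆ Ωnloc δ

end NonlocalPoisson

end

open MeasureTheory Set Filter Topology
open scoped ENNReal

noncomputable section

/-! The error `e = un - ul` has a small residual, and testing with `e` turns that into a bound on
its energy. A Taylor expansion of `ul` to third order, combined with the moment conditions, gives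
`|L_δ ul + s| ≤ Cδ²` on `Ω` (`exists_consistency_bound`). Hence `L_δ e = O(δ²)` there. Symmetry of
the kernel gives the Green identity: the squared energy of `e` equals `-2 ∫ e(x) ∫ (e(y) - e(x))
γ(x,y) dy dx` (`lintegral_energy_eq`). It remains to bound `e` itself.

(a) Here `e` vanishes outside `Ω`. Comparison with a multiple of the paraboloid `R² - ‖x‖²` gives
`|e| = O(δ²)` almost everywhere (`ae_le_of_residual_le`). Both factors in the Green identity are
then `O(δ²)`, so the squared energy is `O(δ⁴)`.

(b) Here `e` vanishes on `Ω_nloc`, and equality of the fluxes removes the contribution of `Ω_loc`.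
The sup bound is replaced by a Poincaré inequality with constant independent of `δ`
(`energyControls_domain`). Young's inequality then absorbs the mass into the energy
(`energy_le_of_residual_le`).

For the Poincaré inequality, walk from `x` in `k` equal steps `z` with `kz` close to a fixed vector
`w`. Telescoping and Cauchy-Schwarz cost a factor `k²`, and `k²‖z‖² ≤ ‖w‖²`. Averaging over a cone
of steps `z`, with weight `‖z‖² ρ_δ(‖z‖)`, therefore gives a bound free of `δ`, because the second
moment of `ρ_δ` is bounded below. Walks that leave `Ω` through the layer where `e = 0` start the
argument. Connectedness spreads the control over `Ω`, and the interior cone condition with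
compactness of the closure makes it global. -/

namespace NonlocalPoisson

/-! ### Nonlocal Green identity and testing with the positive part. -/

section Variational

variable {X : Type*} [MeasurableSpace X] {μ : Measure X} [IsFiniteMeasure μ]
  {γ : X → X → ℝ} {S : Set X} {Λ : ℝ} {p w e : X → ℝ}

/-- A kernel that is square integrable in the second variable, uniformly over the support of `p`,
pairs absolutely with square integrable functions. -/
theorem integrable_kernel_pairing (hγ : Measurable (Function.uncurry γ))
    (hΛ : ∀ x ∈ S, ∫⁻ y, ENNReal.ofReal (γ x y ^ 2) ∂μ ≤ ENNReal.ofReal (Λ ^ 2))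
    (hp : Measurable p) (hw : Measurable w) (hp2 : MemLp p 2 μ) (hw2 : MemLp w 2 μ)
    (hpS : ∀ x, x ∉ S → p x = 0) :
    Integrable (fun q : X × X => p q.1 * ((w q.2 - w q.1) * γ q.1 q.2)) (μ.prod μ) := by
  have hγ' : Measurable fun q : X × X => γ q.1 q.2 := hγ
  have hps : Integrable (fun x => p x ^ 2) μ := hp2.integrable_sq
  have hws : Integrable (fun x => w x ^ 2) μ := hw2.integrable_sq
  have h1 : Integrable (fun q : X × X => p q.1 ^ 2 * γ q.1 q.2 ^ 2) (μ.prod μ) := by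
    refine ⟨by fun_prop, ?_⟩
    rw [hasFiniteIntegral_iff_ofReal (Eventually.of_forall fun q => by positivity)]
    rw [lintegral_prod _ (by fun_prop)]
    calc ∫⁻ x, ∫⁻ y, ENNReal.ofReal (p x ^ 2 * γ x y ^ 2) ∂μ ∂μ
        ≤ ∫⁻ x, ENNReal.ofReal (p x ^ 2) * ENNReal.ofReal (Λ ^ 2) ∂μ := by
          refine lintegral_mono fun x => ?_
          by_cases hx : x ∈ S
          · simp_rw [ENNReal.ofReal_mul (sq_nonneg (p x))]
            rw [lintegral_const_mul' _ _ ENNReal.ofReal_ne_top]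
            gcongr
            exact hΛ x hx
          · simp [hpS x hx]
      _ < ∞ := by
          rw [lintegral_mul_const' _ _ ENNReal.ofReal_ne_top]
          refine ENNReal.mul_lt_top ?_ ENNReal.ofReal_lt_top
          exact (hasFiniteIntegral_iff_ofReal (Eventually.of_forall fun q => sq_nonneg _)).1 hps.2
  have h2 : Integrable (fun q : X × X => w q.1 ^ 2) (μ.prod μ) := hws.comp_fst μ
  have h3 : Integrable (fun q : X × X => w q.2 ^ 2) (μ.prod μ) := hws.comp_snd μ
  -- Young's inequality splits the product into `(pγ)²` and `(w(y) - w(x))² ≤ 2(w(x)² + w(y)²)`.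
  -- Both are integrable, the second because `μ` is finite.
  refine Integrable.mono' (h1.add ((h2.add h3).const_mul 2)) (by fun_prop) ?_
  refine Eventually.of_forall fun q => ?_
  simp only [Pi.add_apply, Real.norm_eq_abs]
  rw [abs_le]
  constructor <;>
  nlinarith [sq_nonneg (p q.1 * γ q.1 q.2 + (w q.2 - w q.1)),
    sq_nonneg (p q.1 * γ q.1 q.2 - (w q.2 - w q.1)), sq_nonneg (w q.1 + w q.2),
    sq_nonneg (p q.1 * γ q.1 q.2)]

theorem integral_kernel_pairing (hγ : Measurable (Function.uncurry γ))
    (hΛ : ∀ x ∈ S, ∫⁻ y, ENNReal.ofReal (γ x y ^ 2) ∂μ ≤ ENNReal.ofReal (Λ ^ 2))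
    (hp : Measurable p) (hw : Measurable w) (hp2 : MemLp p 2 μ) (hw2 : MemLp w 2 μ)
    (hpS : ∀ x, x ∉ S → p x = 0) :
    ∫ q, p q.1 * ((w q.2 - w q.1) * γ q.1 q.2) ∂(μ.prod μ) =
      ∫ x, p x * ∫ y, (w y - w x) * γ x y ∂μ ∂μ := by
  rw [integral_prod _ (integrable_kernel_pairing hγ hΛ hp hw hp2 hw2 hpS)]
  simp_rw [integral_const_mul]

theorem integrable_mul_integral_kernel (hγ : Measurable (Function.uncurry γ))
    (hΛ : ∀ x ∈ S, ∫⁻ y, ENNReal.ofReal (γ x y ^ 2) ∂μ ≤ ENNReal.ofReal (Λ ^ 2))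
    (hp : Measurable p) (hw : Measurable w) (hp2 : MemLp p 2 μ) (hw2 : MemLp w 2 μ)
    (hpS : ∀ x, x ∉ S → p x = 0) :
    Integrable (fun x => p x * ∫ y, (w y - w x) * γ x y ∂μ) μ := by
  have := (integrable_kernel_pairing hγ hΛ hp hw hp2 hw2 hpS).integral_prod_left
  simpa only [integral_const_mul] using this

/-- Exchange `x` and `y` in one of two copies of the integral and use the symmetry of `γ`. The bound
`hΛ` is needed only on `S`, where `p` may be nonzero. -/
theorem two_mul_integral_kernel_pairing (hγ : Measurable (Function.uncurry γ))
    (hsymm : ∀ x y, γ x y = γ y x)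
    (hΛ : ∀ x ∈ S, ∫⁻ y, ENNReal.ofReal (γ x y ^ 2) ∂μ ≤ ENNReal.ofReal (Λ ^ 2))
    (hp : Measurable p) (hw : Measurable w) (hp2 : MemLp p 2 μ) (hw2 : MemLp w 2 μ)
    (hpS : ∀ x, x ∉ S → p x = 0) :
    Integrable (fun q : X × X => (p q.2 - p q.1) * (w q.2 - w q.1) * γ q.1 q.2) (μ.prod μ) ∧
    2 * ∫ x, p x * ∫ y, (w y - w x) * γ x y ∂μ ∂μ =
      -∫ q, (p q.2 - p q.1) * (w q.2 - w q.1) * γ q.1 q.2 ∂(μ.prod μ) := by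
  have hF := integrable_kernel_pairing hγ hΛ hp hw hp2 hw2 hpS
  have hG := hF.swap
  have hs := integral_prod_swap (μ := μ) (ν := μ)
    (fun q : X × X => p q.1 * ((w q.2 - w q.1) * γ q.1 q.2))
  have key : (fun q : X × X => (p q.2 - p q.1) * (w q.2 - w q.1) * γ q.1 q.2) =
      fun q => -(p q.1 * ((w q.2 - w q.1) * γ q.1 q.2) +
        p q.2 * ((w q.1 - w q.2) * γ q.2 q.1)) := by
    funext q
    rw [hsymm q.2 q.1]; ring
  have hG' : Integrable (fun q : X × X => p q.2 * ((w q.1 - w q.2) * γ q.2 q.1)) (μ.prod μ) := hG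
  refine ⟨key ▸ (hF.add hG').neg, ?_⟩
  rw [key, integral_neg, integral_add hF hG', ← integral_kernel_pairing hγ hΛ hp hw hp2 hw2 hpS]
  simp only [Prod.fst_swap, Prod.snd_swap] at hs
  rw [hs]; ring

/-- Nonlocal Green identity for a function vanishing where the kernel is not controlled. -/
theorem lintegral_energy_eq (hγ : Measurable (Function.uncurry γ)) (hγ0 : ∀ x y, 0 ≤ γ x y)
    (hsymm : ∀ x y, γ x y = γ y x)
    (hΛ : ∀ x ∈ S, ∫⁻ y, ENNReal.ofReal (γ x y ^ 2) ∂μ ≤ ENNReal.ofReal (Λ ^ 2))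
    (he : Measurable e) (he2 : MemLp e 2 μ) (heS : ∀ x, x ∉ S → e x = 0) :
    ∫⁻ x, ∫⁻ y, ENNReal.ofReal ((e y - e x) ^ 2 * γ x y) ∂μ ∂μ =
      ENNReal.ofReal (-(2 * ∫ x, e x * ∫ y, (e y - e x) * γ x y ∂μ ∂μ)) := by
  have hγ' : Measurable fun q : X × X => γ q.1 q.2 := hγ
  obtain ⟨hi, heq⟩ := two_mul_integral_kernel_pairing hγ hsymm hΛ he he he2 he2 heS
  rw [heq, neg_neg, ofReal_integral_eq_lintegral_ofReal hi, lintegral_prod]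
  · simp only [sq]
  · fun_prop
  · refine Eventually.of_forall fun q => ?_
    exact mul_nonneg (mul_self_nonneg _) (hγ0 _ _)

/-- Testing with the positive part. -/
theorem integral_posPart_mul_nonpos (hγ : Measurable (Function.uncurry γ))
    (hγ0 : ∀ x y, 0 ≤ γ x y) (hsymm : ∀ x y, γ x y = γ y x)
    (hΛ : ∀ x ∈ S, ∫⁻ y, ENNReal.ofReal (γ x y ^ 2) ∂μ ≤ ENNReal.ofReal (Λ ^ 2))
    (hw : Measurable w) (hw2 : MemLp w 2 μ) (hwS : ∀ x, x ∉ S → w x ≤ 0) :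
    Integrable (fun x => max (w x) 0 * ∫ y, (w y - w x) * γ x y ∂μ) μ ∧
    ∫ x, max (w x) 0 * ∫ y, (w y - w x) * γ x y ∂μ ∂μ ≤ 0 := by
  have hp : Measurable fun x => max (w x) 0 := hw.max measurable_const
  have hp2 : MemLp (fun x => max (w x) 0) 2 μ := hw2.pos_part
  have hpS : ∀ x, x ∉ S → max (w x) 0 = 0 := fun x hx => max_eq_right (hwS x hx)
  refine ⟨integrable_mul_integral_kernel hγ hΛ hp hw hp2 hw2 hpS, ?_⟩
  obtain ⟨-, heq⟩ := two_mul_integral_kernel_pairing hγ hsymm hΛ hp hw hp2 hw2 hpS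
  -- The positive part is monotone, so its increments have the sign of those of `w`.
  have : 0 ≤ ∫ q, (max (w q.2) 0 - max (w q.1) 0) * (w q.2 - w q.1) * γ q.1 q.2 ∂(μ.prod μ) := by
    refine integral_nonneg fun q => mul_nonneg ?_ (hγ0 _ _)
    rcases le_total (w q.1) (w q.2) with h | h
    · exact mul_nonneg (sub_nonneg.2 (max_le_max h le_rfl)) (sub_nonneg.2 h)
    · exact mul_nonneg_of_nonpos_of_nonpos (sub_nonpos.2 (max_le_max h le_rfl))
        (sub_nonpos.2 h)
  linarith

end Variational

/-! ### Taylor expansion and moments: the pointwise truncation error. -/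

section Truncation

variable {d : ℕ} {x : E d} {δ : ℝ} {g : E d → ℝ}

theorem integrable_mul_of_bound_on_ball {f : E d → ℝ} {B : ℝ} (hg : Integrable g)
    (hg_zero : ∀ y, δ ≤ ‖x - y‖ → g y = 0)
    (hf : AEStronglyMeasurable f (volume.restrict (Metric.ball x δ)))
    (hfB : ∀ y ∈ Metric.ball x δ, |f y| ≤ B) : Integrable fun y => f y * g y := by
  have h1 : IntegrableOn (fun y => f y * g y) (Metric.ball x δ) := by
    refine Integrable.bdd_mul (c := B) hg.integrableOn hf ?_
    filter_upwards [ae_restrict_mem measurableSet_ball] with y hy using hfB y hy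
  rw [integrableOn_iff_integrable_of_support_subset] at h1
  · exact h1
  · intro y hy
    by_contra hc
    rw [Metric.mem_ball, not_lt, dist_comm, dist_eq_norm] at hc
    exact hy (by simp [hg_zero y hc])

theorem integral_mul_abs_le_of_bound {f h : E d → ℝ} {B : ℝ} (hg0 : ∀ y, 0 ≤ g y)
    (hg_zero : ∀ y, δ ≤ ‖x - y‖ → g y = 0)
    (hfB : ∀ y ∈ Metric.ball x δ, |f y| ≤ B * h y)
    (hh : Integrable fun y => h y * g y) :
    |∫ y, f y * g y| ≤ B * ∫ y, h y * g y := by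
  rw [← integral_const_mul]
  rw [← Real.norm_eq_abs]
  refine norm_integral_le_of_norm_le (hh.const_mul B) (Eventually.of_forall fun y => ?_)
  rw [Real.norm_eq_abs, abs_mul, abs_of_nonneg (hg0 y), ← mul_assoc]
  by_cases hy : y ∈ Metric.ball x δ
  · exact mul_le_mul_of_nonneg_right (hfB y hy) (hg0 y)
  · rw [Metric.mem_ball, not_lt, dist_comm, dist_eq_norm] at hy
    simp [hg_zero y hy]

theorem abs_coord_le_of_mem_ball {y : E d} (hy : y ∈ Metric.ball x δ) (i : Fin d) :
    |(y - x) i| ≤ δ := by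
  rw [Metric.mem_ball, dist_eq_norm] at hy
  exact (PiLp.norm_apply_le (y - x) i).trans hy.le

theorem integrable_moment (hg : Integrable g) (hg_zero : ∀ y, δ ≤ ‖x - y‖ → g y = 0)
    {k : ℕ} (r : Fin k → Fin d) : Integrable fun y => (∏ i, (y - x) (r i)) * g y := by
  refine integrable_mul_of_bound_on_ball (B := δ ^ k) hg hg_zero ?_ fun y hy => ?_
  · exact (by fun_prop : Continuous fun y : E d => ∏ i, (y - x) (r i)).aestronglyMeasurable
  · rw [Finset.abs_prod]
    refine (Finset.prod_le_prod (fun _ _ => abs_nonneg _)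
      fun i _ => abs_coord_le_of_mem_ball hy (r i)).trans ?_
    simp

/-- A multilinear form evaluated on the diagonal, in coordinates. -/
theorem multilinear_diag_eq_sum {k : ℕ} (T : ContinuousMultilinearMap ℝ (fun _ : Fin k => E d) ℝ)
    (h : E d) :
    T (fun _ => h) = ∑ r : Fin k → Fin d,
      (∏ i, h (r i)) * T fun i => EuclideanSpace.basisFun (Fin d) ℝ (r i) := by
  have hh : h = ∑ j, h j • EuclideanSpace.basisFun (Fin d) ℝ j := by
    conv_lhs => rw [← (EuclideanSpace.basisFun (Fin d) ℝ).sum_repr h]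
    simp
  conv_lhs => rw [hh]
  rw [T.map_sum]
  refine Finset.sum_congr rfl fun r _ => ?_
  rw [T.map_smul_univ (fun i => h (r i))]
  rfl

theorem abs_multilinear_basis_le {k : ℕ} {M : ℝ}
    {T : ContinuousMultilinearMap ℝ (fun _ : Fin k => E d) ℝ} (hT : ‖T‖ ≤ M)
    (r : Fin k → Fin d) : |T fun i => EuclideanSpace.basisFun (Fin d) ℝ (r i)| ≤ M := by
  refine (T.le_opNorm _).trans ?_
  simpa using hT

theorem integrable_multilinear_mul {k : ℕ}
    (T : ContinuousMultilinearMap ℝ (fun _ : Fin k => E d) ℝ)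
    (hg : Integrable g) (hg_zero : ∀ y, δ ≤ ‖x - y‖ → g y = 0) :
    Integrable fun y => T (fun _ => y - x) * g y := by
  simp_rw [multilinear_diag_eq_sum T, Finset.sum_mul]
  refine integrable_finsetSum _ fun r _ => ?_
  refine ((integrable_moment hg hg_zero r).const_mul
    (T fun i => EuclideanSpace.basisFun (Fin d) ℝ (r i))).congr (Eventually.of_forall fun y => ?_)
  ring

theorem integral_multilinear_mul {k : ℕ}
    (T : ContinuousMultilinearMap ℝ (fun _ : Fin k => E d) ℝ)
    (hg : Integrable g) (hg_zero : ∀ y, δ ≤ ‖x - y‖ → g y = 0) :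
    ∫ y, T (fun _ => y - x) * g y = ∑ r : Fin k → Fin d,
      (∫ y, (∏ i, (y - x) (r i)) * g y) * T fun i => EuclideanSpace.basisFun (Fin d) ℝ (r i) := by
  simp_rw [multilinear_diag_eq_sum T, Finset.sum_mul]
  rw [integral_finsetSum]
  · refine Finset.sum_congr rfl fun r _ => ?_
    rw [← integral_mul_const]
    refine integral_congr_ae (Eventually.of_forall fun y => ?_)
    simp only; ring
  · intro r _
    refine ((integrable_moment hg hg_zero r).const_mul
      (T fun i => EuclideanSpace.basisFun (Fin d) ℝ (r i))).congr
        (Eventually.of_forall fun y => ?_)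
    ring

/-- If the `k`-th moments are within `η` of `m`, so is the integral of a `k`-linear form. -/
theorem abs_integral_multilinear_sub_le {k : ℕ} {M η : ℝ} {m : (Fin k → Fin d) → ℝ}
    {T : ContinuousMultilinearMap ℝ (fun _ : Fin k => E d) ℝ} (hT : ‖T‖ ≤ M)
    (hg : Integrable g) (hg_zero : ∀ y, δ ≤ ‖x - y‖ → g y = 0) (hη : 0 ≤ η)
    (hm : ∀ r : Fin k → Fin d, |(∫ y, (∏ i, (y - x) (r i)) * g y) - m r| ≤ η) :
    |(∫ y, T (fun _ => y - x) * g y) -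
      ∑ r, m r * T fun i => EuclideanSpace.basisFun (Fin d) ℝ (r i)| ≤ (d : ℝ) ^ k * (η * M) := by
  rw [integral_multilinear_mul T hg hg_zero, ← Finset.sum_sub_distrib]
  refine (Finset.abs_sum_le_sum_abs _ _).trans ?_
  calc _ ≤ ∑ _r : Fin k → Fin d, η * M := by
        refine Finset.sum_le_sum fun r _ => ?_
        rw [← sub_mul, abs_mul]
        exact mul_le_mul (hm r) (abs_multilinear_basis_le hT r) (abs_nonneg _) hη
    _ = _ := by simp

theorem sum_diag_basis_eq_laplacian (u : E d → ℝ) (x : E d) :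
    ∑ r : Fin 2 → Fin d, (if r 0 = r 1 then (1 : ℝ) else 0) *
      iteratedFDeriv ℝ 2 u x (fun i => EuclideanSpace.basisFun (Fin d) ℝ (r i)) =
    Laplacian.laplacian u x := by
  rw [InnerProductSpace.laplacian_eq_iteratedFDeriv_orthonormalBasis u
    (EuclideanSpace.basisFun (Fin d) ℝ)]
  rw [← (finTwoArrowEquiv (Fin d)).symm.sum_comp, Fintype.sum_prod_type]
  refine Finset.sum_congr rfl fun i _ => ?_
  rw [Finset.sum_eq_single i]
  · simp only [finTwoArrowEquiv_symm_apply, Matrix.cons_val_zero, Matrix.cons_val_one, if_true,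
      one_mul]
    congr 1
    funext j
    fin_cases j <;> rfl
  · intro j _ hj
    simp [hj.symm]
  · simp

/-- The segment from `x` to `y` stays in the ball, so Taylor's formula with integral remainder
applies. The sharp factor `1/24` is dropped. -/
theorem abs_taylor_remainder_le {u : E d → ℝ} {M : ℝ}
    (hu : ContDiffOn ℝ 4 u (Metric.ball x δ))
    (hM : ∀ y ∈ Metric.ball x δ, ‖iteratedFDeriv ℝ 4 u y‖ ≤ M) {y : E d}
    (hy : y ∈ Metric.ball x δ) :
    |u y - u x - (iteratedFDeriv ℝ 1 u x (fun _ => y - x) +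
      (1 / 2) * iteratedFDeriv ℝ 2 u x (fun _ => y - x) +
      (1 / 6) * iteratedFDeriv ℝ 3 u x (fun _ => y - x))| ≤ M * ‖y - x‖ ^ 4 := by
  have hδ : 0 < δ := Metric.pos_of_mem_ball hy
  have hseg : ∀ t ∈ Icc (0 : ℝ) 1, x + t • (y - x) ∈ Metric.ball x δ := fun t ht =>
    (convex_ball x δ).add_smul_sub_mem (Metric.mem_ball_self hδ) hy ht
  have h := map_add_eq_sum_add_integral_iteratedFDeriv (f := u) (x := x) (y := y - x) (n := 3)
    fun t ht => (hu.contDiffAt (Metric.isOpen_ball.mem_nhds (hseg t ht))).of_le (by norm_num)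
  simp only [Finset.sum_range_succ, Finset.sum_range_zero, Nat.factorial, smul_eq_mul,
    add_sub_cancel, iteratedFDeriv_zero_apply] at h
  have hb : ‖∫ t in (0 : ℝ)..1, (1 - t) ^ 3 * iteratedFDeriv ℝ (3 + 1) u (x + t • (y - x))
      (fun _ => y - x)‖ ≤ (M * ‖y - x‖ ^ 4) * |(1 : ℝ) - 0| := by
    refine intervalIntegral.norm_integral_le_of_norm_le_const fun t ht => ?_
    rw [uIoc_of_le zero_le_one] at ht
    rw [norm_mul]
    have h1 : ‖(1 - t) ^ 3‖ ≤ 1 := by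
      rw [norm_pow, Real.norm_eq_abs]
      refine pow_le_one₀ (abs_nonneg _) ?_
      rw [abs_le]; constructor <;> linarith [ht.1, ht.2]
    have h2 := (iteratedFDeriv ℝ (3 + 1) u (x + t • (y - x))).le_opNorm (fun _ => y - x)
    have h3 := hM _ (hseg t ⟨ht.1.le, ht.2⟩)
    have h4 : ‖iteratedFDeriv ℝ (3 + 1) u (x + t • (y - x)) (fun _ => y - x)‖ ≤
        M * ‖y - x‖ ^ 4 := by
      refine h2.trans ?_
      simp only [Finset.prod_const, Finset.card_univ, Fintype.card_fin]
      exact mul_le_mul_of_nonneg_right h3 (by positivity)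
    calc _ ≤ 1 * (M * ‖y - x‖ ^ 4) := mul_le_mul h1 h4 (norm_nonneg _) zero_le_one
      _ = _ := one_mul _
  rw [sub_zero, abs_one, mul_one, Real.norm_eq_abs] at hb
  have heq : u y - u x - (iteratedFDeriv ℝ 1 u x (fun _ => y - x) +
      (1 / 2) * iteratedFDeriv ℝ 2 u x (fun _ => y - x) +
      (1 / 6) * iteratedFDeriv ℝ 3 u x (fun _ => y - x)) =
      (1 / 6) * ∫ t in (0 : ℝ)..1, (1 - t) ^ 3 *
        iteratedFDeriv ℝ (3 + 1) u (x + t • (y - x)) (fun _ => y - x) := by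
    rw [h]; norm_num; ring
  rw [heq, abs_mul, abs_of_pos (by norm_num : (0 : ℝ) < 1 / 6)]
  nlinarith [abs_nonneg (∫ t in (0 : ℝ)..1, (1 - t) ^ 3 *
        iteratedFDeriv ℝ (3 + 1) u (x + t • (y - x)) (fun _ => y - x))]

theorem norm_sub_sq_eq_sum (x y : E d) : ‖y - x‖ ^ 2 = ∑ i, (y - x) i * (y - x) i := by
  rw [EuclideanSpace.norm_sq_eq]
  simp [sq]

theorem integrable_norm_sq_mul (hg : Integrable g) (hg_zero : ∀ y, δ ≤ ‖x - y‖ → g y = 0) :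
    Integrable fun y => ‖y - x‖ ^ 2 * g y := by
  simp_rw [norm_sub_sq_eq_sum, Finset.sum_mul]
  refine integrable_finsetSum _ fun i _ => ?_
  simpa [Fin.prod_univ_two] using integrable_moment hg hg_zero ![i, i]

theorem abs_integral_norm_sq_mul_sub_le {η : ℝ} (hg : Integrable g)
    (hg_zero : ∀ y, δ ≤ ‖x - y‖ → g y = 0)
    (h2 : ∀ i j, |(∫ y, (y - x) i * (y - x) j * g y) - (if i = j then 1 else 0)| ≤ η) :
    |(∫ y, ‖y - x‖ ^ 2 * g y) - d| ≤ d * η := by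
  simp_rw [norm_sub_sq_eq_sum, Finset.sum_mul]
  rw [integral_finsetSum _ fun i _ => by
    simpa [Fin.prod_univ_two] using integrable_moment hg hg_zero ![i, i]]
  have : (d : ℝ) = ∑ _i : Fin d, (1 : ℝ) := by simp
  conv_lhs => rw [this]
  rw [← Finset.sum_sub_distrib]
  refine (Finset.abs_sum_le_sum_abs _ _).trans ?_
  calc _ ≤ ∑ _i : Fin d, η := Finset.sum_le_sum fun i _ => by simpa using h2 i i
    _ = _ := by simp

/-- Consistency of the nonlocal Laplacian with the Laplacian, at one point. -/
theorem abs_two_mul_integral_sub_laplacian_le {u : E d → ℝ} {M K : ℝ} (hδ : 0 < δ) (hδ1 : δ ≤ 1)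
    (hg : Integrable g) (hg0 : ∀ y, 0 ≤ g y) (hg_zero : ∀ y, δ ≤ ‖x - y‖ → g y = 0)
    (hK : 0 ≤ K)
    (h1 : ∀ i, |∫ y, (y - x) i * g y| ≤ K * δ ^ 2)
    (h2 : ∀ i j, |(∫ y, (y - x) i * (y - x) j * g y) - (if i = j then 1 else 0)| ≤ K * δ ^ 2)
    (h3 : ∀ i j k, |∫ y, (y - x) i * (y - x) j * (y - x) k * g y| ≤ K * δ ^ 2)
    (hu : ContDiffOn ℝ 4 u (Metric.ball x δ))
    (hM : ∀ k ≤ 4, ∀ y ∈ Metric.ball x δ, ‖iteratedFDeriv ℝ k u y‖ ≤ M) :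
    |2 * (∫ y, (u y - u x) * g y) - Laplacian.laplacian u x| ≤
      ((2 * d + d ^ 2 + d ^ 3) * (K * M) + 2 * M * (d + d * K)) * δ ^ 2 := by
  have hx : x ∈ Metric.ball x δ := Metric.mem_ball_self hδ
  have hM0 : 0 ≤ M := (norm_nonneg _).trans (hM 0 (by norm_num) x hx)
  set T1 := iteratedFDeriv ℝ 1 u x
  set T2 := iteratedFDeriv ℝ 2 u x with hT2
  set T3 := iteratedFDeriv ℝ 3 u x
  have i1 := integrable_multilinear_mul T1 hg hg_zero
  have i2 := integrable_multilinear_mul T2 hg hg_zero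
  have i3 := integrable_multilinear_mul T3 hg hg_zero
  have iu : Integrable fun y => (u y - u x) * g y := by
    refine integrable_mul_of_bound_on_ball (B := M + M) hg hg_zero ?_ fun y hy => ?_
    · exact (hu.continuousOn.sub continuousOn_const).aestronglyMeasurable measurableSet_ball
    · have := hM 0 (by norm_num) y hy
      have h' := hM 0 (by norm_num) x hx
      rw [norm_iteratedFDeriv_zero] at this h'
      exact (abs_sub _ _).trans (add_le_add this h')
  -- The fourth-order remainder. Two of its four powers of `‖y - x‖` give `δ²`; the other two are
  -- paid for by the second moment.
  set R : E d → ℝ := fun y => u y - u x - (T1 (fun _ => y - x) + (1 / 2) * T2 (fun _ => y - x) +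
    (1 / 6) * T3 (fun _ => y - x))
  have hsum : (fun y => (u y - u x) * g y) = fun y => T1 (fun _ => y - x) * g y +
      ((1 / 2) * (T2 (fun _ => y - x) * g y) + ((1 / 6) * (T3 (fun _ => y - x) * g y) +
        R y * g y)) := by
    funext y; simp only [R]; ring
  have iR : Integrable fun y => R y * g y := by
    refine (iu.sub (i1.add ((i2.const_mul (1 / 2)).add (i3.const_mul (1 / 6))))).congr
      (Eventually.of_forall fun y => ?_)
    simp only [R, Pi.sub_apply, Pi.add_apply]; ring
  have e1 : |∫ y, T1 (fun _ => y - x) * g y| ≤ (d : ℝ) ^ 1 * (K * δ ^ 2 * M) := by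
    have := abs_integral_multilinear_sub_le (m := fun _ => 0) (η := K * δ ^ 2)
      (hM 1 (by norm_num) x hx) hg hg_zero (by positivity) (fun r => by
        simpa using h1 (r 0))
    simpa only [zero_mul, Finset.sum_const_zero, sub_zero] using this
  have e2 : |(∫ y, T2 (fun _ => y - x) * g y) - Laplacian.laplacian u x| ≤
      (d : ℝ) ^ 2 * (K * δ ^ 2 * M) := by
    have := abs_integral_multilinear_sub_le (m := fun r => if r 0 = r 1 then 1 else 0)
      (η := K * δ ^ 2) (hM 2 (by norm_num) x hx) hg hg_zero (by positivity) (fun r => by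
        simpa only [Fin.prod_univ_two] using h2 (r 0) (r 1))
    rwa [sum_diag_basis_eq_laplacian] at this
  have e3 : |∫ y, T3 (fun _ => y - x) * g y| ≤ (d : ℝ) ^ 3 * (K * δ ^ 2 * M) := by
    have := abs_integral_multilinear_sub_le (m := fun _ => 0) (η := K * δ ^ 2)
      (hM 3 (by norm_num) x hx) hg hg_zero (by positivity) (fun r => by
        simpa only [Fin.prod_univ_three, sub_zero] using h3 (r 0) (r 1) (r 2))
    simpa only [zero_mul, Finset.sum_const_zero, sub_zero] using this
  have eR : |∫ y, R y * g y| ≤ M * δ ^ 2 * ∫ y, ‖y - x‖ ^ 2 * g y := by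
    refine integral_mul_abs_le_of_bound hg0 hg_zero (fun y hy => ?_)
      (integrable_norm_sq_mul hg hg_zero)
    refine (abs_taylor_remainder_le hu (hM 4 le_rfl) hy).trans ?_
    rw [Metric.mem_ball, dist_eq_norm] at hy
    have : ‖y - x‖ ^ 2 ≤ δ ^ 2 := by gcongr
    calc M * ‖y - x‖ ^ 4 = M * ‖y - x‖ ^ 2 * ‖y - x‖ ^ 2 := by ring
      _ ≤ M * δ ^ 2 * ‖y - x‖ ^ 2 := by gcongr
  have eq2 := abs_integral_norm_sq_mul_sub_le hg hg_zero h2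
  have hδ2 : δ ^ 2 ≤ 1 := pow_le_one₀ hδ.le hδ1
  have eq3 : ∫ y, ‖y - x‖ ^ 2 * g y ≤ d + d * K := by
    have : (d : ℝ) * (K * δ ^ 2) ≤ d * K := by
      rw [← mul_assoc]; exact mul_le_of_le_one_right (by positivity) hδ2
    linarith [(abs_le.1 eq2).2]
  have eR' : |∫ y, R y * g y| ≤ M * δ ^ 2 * (d + d * K) := eR.trans (by gcongr)
  have htot : 2 * (∫ y, (u y - u x) * g y) - Laplacian.laplacian u x =
      2 * (∫ y, T1 (fun _ => y - x) * g y) +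
      ((∫ y, T2 (fun _ => y - x) * g y) - Laplacian.laplacian u x) +
      (1 / 3) * (∫ y, T3 (fun _ => y - x) * g y) + 2 * ∫ y, R y * g y := by
    have j3 : Integrable fun y => (1 / 6) * (T3 (fun _ => y - x) * g y) + R y * g y :=
      (i3.const_mul _).add iR
    have j2 : Integrable fun y => (1 / 2) * (T2 (fun _ => y - x) * g y) +
        ((1 / 6) * (T3 (fun _ => y - x) * g y) + R y * g y) := (i2.const_mul _).add j3
    rw [hsum, integral_add i1 j2, integral_add (i2.const_mul _) j3,
      integral_add (i3.const_mul _) iR, integral_const_mul, integral_const_mul]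
    ring
  rw [htot]
  have hnn : 0 ≤ (d : ℝ) ^ 3 * (K * δ ^ 2 * M) := by positivity
  rw [abs_le] at *
  constructor <;> nlinarith [e1.1, e1.2, e2.1, e2.2, e3.1, e3.2, eR'.1, eR'.2]

end Truncation

/-! ### The domain with its interaction layer as an open thickening. -/

section Domain

variable {d : ℕ} {Ω : Set (E d)} {δ : ℝ}

theorem fullDomain_eq_thickening (hδ : 0 < δ) : fullDomain Ω δ = Metric.thickening δ Ω := by
  ext y
  simp only [fullDomain, interactionDomain, mem_union, mem_ofPred_eq, Metric.mem_thickening_iff,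
    dist_eq_norm]
  constructor
  · rintro (h | h)
    · exact ⟨y, h, by simpa using hδ⟩
    · exact h.2
  · intro h
    by_cases hy : y ∈ Ω
    · exact Or.inl hy
    · exact Or.inr ⟨hy, h⟩

theorem ball_subset_fullDomain (hδ : 0 < δ) {x : E d} (hx : x ∈ Ω) :
    Metric.ball x δ ⊆ fullDomain Ω δ := by
  rw [fullDomain_eq_thickening hδ]
  exact Metric.ball_subset_thickening hx δ

theorem isOpen_fullDomain (hδ : 0 < δ) : IsOpen (fullDomain Ω δ) := by
  rw [fullDomain_eq_thickening hδ]
  exact Metric.isOpen_thickening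

theorem measurableSet_fullDomain (hδ : 0 < δ) : MeasurableSet (fullDomain Ω δ) :=
  (isOpen_fullDomain hδ).measurableSet

theorem subset_fullDomain : Ω ⊆ fullDomain Ω δ := subset_union_left

theorem fullDomain_subset_thickening_one (hδ : 0 < δ) (hδ1 : δ ≤ 1) :
    fullDomain Ω δ ⊆ Metric.thickening 1 Ω := by
  rw [fullDomain_eq_thickening hδ]
  exact Metric.thickening_mono hδ1 Ω

theorem volume_thickening_one_lt_top (hΩ : Bornology.IsBounded Ω) :
    volume (Metric.thickening 1 Ω) < ∞ :=
  hΩ.thickening.measure_lt_top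

theorem isFiniteMeasure_restrict_fullDomain (hΩ : Bornology.IsBounded Ω) (hδ : 0 < δ) :
    IsFiniteMeasure (volume.restrict (fullDomain Ω δ)) := by
  rw [fullDomain_eq_thickening hδ]
  exact isFiniteMeasure_restrict.2 hΩ.thickening.measure_lt_top.ne

/-- For `x ∈ Ω` the kernel lives on the `δ`-ball about `x`, which lies inside the full domain. This
reconciles the integral over the whole space in the Laplacian with the one in the energy. -/
theorem integral_fullDomain_eq {γ : E d → E d → ℝ} (hγ : IsIntegrableKernel Ω δ γ) (hδ : 0 < δ)
    {x : E d} (hx : x ∈ Ω) (f : E d → ℝ) :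
    ∫ y in fullDomain Ω δ, f y * γ x y = ∫ y, f y * γ x y := by
  refine setIntegral_eq_integral_of_forall_compl_eq_zero fun y hy => ?_
  have : δ ≤ ‖x - y‖ := by
    by_contra h
    rw [not_le, ← dist_eq_norm, dist_comm] at h
    exact hy (ball_subset_fullDomain hδ hx h)
  simp [hγ.eq_zero x hx y this]

end Domain

/-! ### Square integrable kernels acting on square integrable functions. -/

section Kernel

variable {X : Type*} [MeasurableSpace X] {μ : Measure X} {γ : X → X → ℝ} {Λ : ℝ}

theorem memLp_two_of_lintegral_sq_le {f : X → ℝ} (hf : Measurable f)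
    (h : ∫⁻ y, ENNReal.ofReal (f y ^ 2) ∂μ ≤ ENNReal.ofReal (Λ ^ 2)) : MemLp f 2 μ := by
  rw [memLp_two_iff_integrable_sq hf.aestronglyMeasurable]
  refine ⟨by fun_prop, ?_⟩
  rw [hasFiniteIntegral_iff_ofReal (Eventually.of_forall fun _ => sq_nonneg _)]
  exact h.trans_lt ENNReal.ofReal_lt_top

theorem integrable_sub_mul_kernel [IsFiniteMeasure μ] {f k : X → ℝ} (hf : MemLp f 2 μ)
    (hk : MemLp k 2 μ) (c : ℝ) : Integrable (fun y => (f y - c) * k y) μ :=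
  (hf.sub (memLp_const c)).integrable_mul hk

theorem integral_kernel_sub_of_ae_eq [IsFiniteMeasure μ] {e u v k : X → ℝ} (hu : MemLp u 2 μ)
    (hv : MemLp v 2 μ) (hk : MemLp k 2 μ) (he : e =ᵐ[μ] u - v) {x : X} (hx : e x = u x - v x) :
    ∫ y, (e y - e x) * k y ∂μ =
      (∫ y, (u y - u x) * k y ∂μ) - ∫ y, (v y - v x) * k y ∂μ := by
  rw [← integral_sub (integrable_sub_mul_kernel hu hk _) (integrable_sub_mul_kernel hv hk _)]
  refine integral_congr_ae ?_
  filter_upwards [he] with y hy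
  rw [hy, hx, Pi.sub_apply]; ring

end Kernel

theorem IsIntegrableKernel.memLp_two {d : ℕ} {Ω : Set (E d)} {δ : ℝ} {γ : E d → E d → ℝ}
    (hγ : IsIntegrableKernel Ω δ γ) {x : E d} (hx : x ∈ Ω) :
    MemLp (γ x) 2 (volume.restrict (fullDomain Ω δ)) := by
  obtain ⟨γ₂, -, h⟩ := hγ.upper
  exact memLp_two_of_lintegral_sq_le (hγ.measurable.of_uncurry_left (x := x)) (h x hx)

theorem IsIntegrableKernel.integrable {d : ℕ} {Ω : Set (E d)} {δ : ℝ} {γ : E d → E d → ℝ}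
    (hγ : IsIntegrableKernel Ω δ γ) (hΩ : Bornology.IsBounded Ω) (hδ : 0 < δ) {x : E d}
    (hx : x ∈ Ω) : Integrable (γ x) := by
  have := isFiniteMeasure_restrict_fullDomain hΩ hδ
  have h : IntegrableOn (γ x) (fullDomain Ω δ) :=
    (hγ.memLp_two hx).integrable (by norm_num)
  rwa [integrableOn_iff_integrable_of_support_subset] at h
  intro y hy
  by_contra hc
  refine hy (hγ.eq_zero x hx y ?_)
  by_contra h'
  rw [not_le, ← dist_eq_norm, dist_comm] at h'
  exact hc (ball_subset_fullDomain hδ hx h')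

/-! ### Representatives of the error and its energy seminorm. -/

section Error

variable {d : ℕ} {U Z : Set (E d)} {γ : E d → E d → ℝ}

/-- The Green identity and the maximum principle need a measurable function vanishing at every point
off the controlled set, not just almost everywhere. Cutting a measurable representative off by an
indicator achieves this. -/
theorem exists_error_representative {un ul : E d → ℝ} (hU : MeasurableSet U)
    (hZ : MeasurableSet Z) (hun : MemLp un 2 (volume.restrict U))
    (hul : MemLp ul 2 (volume.restrict U)) (h : ∀ᵐ x ∂volume.restrict Z, un x = ul x) :
    ∃ e : E d → ℝ, Measurable e ∧ MemLp e 2 (volume.restrict U) ∧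
      e =ᵐ[volume.restrict U] un - ul ∧ ∀ x, x ∉ U \ Z → e x = 0 := by
  have hs := hun.sub hul
  set f := hs.1.mk (un - ul) with hf
  have hfm : Measurable f := hs.1.stronglyMeasurable_mk.measurable
  have hfe : un - ul =ᵐ[volume.restrict U] f := hs.1.ae_eq_mk
  have hae : (U \ Z).indicator f =ᵐ[volume.restrict U] un - ul := by
    rw [ae_restrict_iff' hZ] at h
    filter_upwards [hfe, ae_restrict_of_ae h, ae_restrict_mem hU] with x h1 h2 h3
    by_cases hxZ : x ∈ Z
    · rw [indicator_of_notMem (fun hc => hc.2 hxZ), Pi.sub_apply, h2 hxZ, sub_self]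
    · rw [indicator_of_mem (show x ∈ U \ Z from ⟨h3, hxZ⟩), h1]
  exact ⟨(U \ Z).indicator f, hfm.indicator (hU.diff hZ), hs.ae_eq hae.symm, hae,
    fun x hx => indicator_of_notMem hx f⟩

theorem energySeminorm_congr_ae {v e : E d → ℝ} (h : e =ᵐ[volume.restrict U] v) :
    energySeminorm γ U v = energySeminorm γ U e := by
  unfold energySeminorm
  congr 1
  refine lintegral_congr_ae ?_
  filter_upwards [h] with x hx
  refine lintegral_congr_ae ?_
  filter_upwards [h] with y hy
  simp only [hx, hy]

theorem energySeminorm_le_of_lintegral_le {v : E d → ℝ} {C : ℝ} (hC : 0 ≤ C)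
    (h : ∫⁻ x in U, ∫⁻ y in U, ENNReal.ofReal ((v y - v x) ^ 2 * γ x y) ≤
      ENNReal.ofReal (C ^ 2)) : energySeminorm γ U v ≤ ENNReal.ofReal C := by
  unfold energySeminorm
  refine (ENNReal.rpow_le_rpow h (by norm_num)).trans (le_of_eq ?_)
  rw [ENNReal.ofReal_pow hC, ← ENNReal.rpow_natCast, ← ENNReal.rpow_mul]
  norm_num

end Error

/-! ### Weak maximum principle and energy bounds from the residual. -/

section MaximumPrinciple

variable {X : Type*} [MeasurableSpace X] {μ : Measure X} [IsFiniteMeasure μ]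
  {γ : X → X → ℝ} {S : Set X} {Λ : ℝ} {w e : X → ℝ}

/-- Weak maximum principle for strict nonlocal subsolutions. -/
theorem ae_nonpos_of_strict_subsolution (hγ : Measurable (Function.uncurry γ))
    (hγ0 : ∀ x y, 0 ≤ γ x y) (hsymm : ∀ x y, γ x y = γ y x)
    (hΛ : ∀ x ∈ S, ∫⁻ y, ENNReal.ofReal (γ x y ^ 2) ∂μ ≤ ENNReal.ofReal (Λ ^ 2))
    (hw : Measurable w) (hw2 : MemLp w 2 μ) (hwS : ∀ x, x ∉ S → w x ≤ 0)
    (hsub : ∀ᵐ x ∂μ, x ∈ S → 0 < ∫ y, (w y - w x) * γ x y ∂μ) : ∀ᵐ x ∂μ, w x ≤ 0 := by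
  obtain ⟨hi, hle⟩ := integral_posPart_mul_nonpos hγ hγ0 hsymm hΛ hw hw2 hwS
  -- The test integral is at most zero while its integrand is nonnegative, so the integrand
  -- vanishes; strictness of the subsolution then leaves only a zero positive part.
  have hnn : 0 ≤ᵐ[μ] fun x => max (w x) 0 * ∫ y, (w y - w x) * γ x y ∂μ := by
    filter_upwards [hsub] with x hx
    by_cases hxS : x ∈ S
    · exact mul_nonneg (le_max_right _ _) (hx hxS).le
    · simp [max_eq_right (hwS x hxS)]
  have h0 := (integral_eq_zero_iff_of_nonneg_ae hnn hi).1 (le_antisymm hle (integral_nonneg_of_ae hnn))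
  filter_upwards [h0, hsub] with x hx hs
  by_cases hxS : x ∈ S
  · rcases mul_eq_zero.1 hx with h | h
    · exact (le_max_left _ _).trans h.le
    · exact absurd h (hs hxS).ne'
  · exact hwS x hxS

theorem lintegral_energy_le_of_ae_bound (hγ : Measurable (Function.uncurry γ))
    (hγ0 : ∀ x y, 0 ≤ γ x y) (hsymm : ∀ x y, γ x y = γ y x)
    (hΛ : ∀ x ∈ S, ∫⁻ y, ENNReal.ofReal (γ x y ^ 2) ∂μ ≤ ENNReal.ofReal (Λ ^ 2))
    (he : Measurable e) (he2 : MemLp e 2 μ) (heS : ∀ x, x ∉ S → e x = 0) {f : X → ℝ}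
    (hf : Integrable f μ)
    (hef : ∀ᵐ x ∂μ, |e x| * |2 * ∫ y, (e y - e x) * γ x y ∂μ| ≤ f x) :
    ∫⁻ x, ∫⁻ y, ENNReal.ofReal ((e y - e x) ^ 2 * γ x y) ∂μ ∂μ ≤
      ENNReal.ofReal (∫ x, f x ∂μ) := by
  rw [lintegral_energy_eq hγ hγ0 hsymm hΛ he he2 heS]
  refine ENNReal.ofReal_le_ofReal ?_
  rw [← integral_const_mul, ← integral_neg]
  refine integral_mono_ae
    ((integrable_mul_integral_kernel hγ hΛ he he he2 he2 heS).const_mul 2).neg hf ?_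
  filter_upwards [hef] with x hx
  refine le_trans ?_ hx
  rw [← abs_mul]
  refine le_trans (le_of_eq ?_) (neg_le_abs _)
  ring

end MaximumPrinciple

/-! ### Uniform consistency, the paraboloid barrier and the Dirichlet-to-Dirichlet estimate. -/

variable {d : ℕ}

theorem memLp_two_of_uniformlyC4 {Ω : Set (E d)} {δ M : ℝ} {u : E d → ℝ}
    (hΩ : Bornology.IsBounded Ω) (hδ : 0 < δ) (hu : ContinuousOn u (fullDomain Ω δ))
    (hM : ∀ x ∈ fullDomain Ω δ, ‖iteratedFDeriv ℝ 0 u x‖ ≤ M) :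
    MemLp u 2 (volume.restrict (fullDomain Ω δ)) := by
  have := isFiniteMeasure_restrict_fullDomain hΩ hδ
  refine MemLp.of_bound (hu.aestronglyMeasurable (measurableSet_fullDomain hδ)) M ?_
  filter_upwards [ae_restrict_mem (measurableSet_fullDomain hδ)] with x hx
  simpa using hM x hx

/-- Uniform consistency: the local solution solves the nonlocal equation up to `O(δ²)`. -/
theorem exists_consistency_bound {Ω : Set (E d)} (hΩ_bdd : Bornology.IsBounded Ω) {δ₀ : ℝ}
    {γ : ℝ → E d → E d → ℝ} (hγ : ∀ δ ∈ Ioc 0 δ₀, IsIntegrableKernel Ω δ (γ δ))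
    (hγ_scale : ProperlyScaled Ω δ₀ γ) {s ul : ℝ → E d → ℝ}
    (hcd : ∀ δ ∈ Ioc 0 δ₀, ContDiffOn ℝ 4 (ul δ) (fullDomain Ω δ))
    (hpoisson : ∀ δ ∈ Ioc 0 δ₀, ∀ x ∈ fullDomain Ω δ, -(Laplacian.laplacian (ul δ) x) = s δ x)
    (hul_C4 : UniformlyC4 Ω δ₀ ul) :
    ∃ C > 0, ∀ δ ∈ Ioc 0 δ₀, δ ≤ 1 → ∀ x ∈ Ω,
      |nonlocalLaplacian (γ δ) (ul δ) x + s δ x| ≤ C * δ ^ 2 := by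
  obtain ⟨K, hK⟩ := hγ_scale
  obtain ⟨M, hM⟩ := hul_C4
  set A : ℝ := (2 * d + d ^ 2 + d ^ 3) * (|K| * |M|) + 2 * |M| * (d + d * |K|) with hA
  have hA0 : 0 ≤ A := by positivity
  -- The added `1` makes the constant strictly positive, as the strict comparison with the barrier
  -- requires.
  refine ⟨A + 1, by positivity, fun δ hδ hδ1 x hx => ?_⟩
  have hsub := ball_subset_fullDomain (Ω := Ω) hδ.1 hx
  obtain ⟨h1, h2, h3⟩ := hK δ hδ x hx
  have hKδ : K * δ ^ 2 ≤ |K| * δ ^ 2 := by gcongr; exact le_abs_self K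
  have key := abs_two_mul_integral_sub_laplacian_le (u := ul δ) (M := |M|) (K := |K|) hδ.1 hδ1
    ((hγ δ hδ).integrable hΩ_bdd hδ.1 hx) ((hγ δ hδ).nonneg x) ((hγ δ hδ).eq_zero x hx)
    (abs_nonneg K) (fun i => (h1 i).trans hKδ) (fun i j => (h2 i j).trans hKδ)
    (fun i j k => (h3 i j k).trans hKδ) ((hcd δ hδ).mono hsub)
    (fun k hk y hy => (hM δ hδ k hk y (hsub hy)).trans (le_abs_self M))
  rw [← hpoisson δ hδ x (subset_fullDomain hx), ← sub_eq_add_neg]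
  refine key.trans ?_
  rw [← hA]
  nlinarith [sq_nonneg δ]

/-- The error between a nonlocal and the local solution has residual `O(δ²)` in `Ω`. -/
theorem ae_abs_residual_le {Ω : Set (E d)} (hΩ_open : IsOpen Ω) (hΩ_bdd : Bornology.IsBounded Ω)
    {δ η : ℝ} (hδ : 0 < δ) {γ : E d → E d → ℝ} (hγ : IsIntegrableKernel Ω δ γ)
    {s ul un e : E d → ℝ}
    (hcons : ∀ x ∈ Ω, |nonlocalLaplacian γ ul x + s x| ≤ η)
    (hun : MemLp un 2 (volume.restrict (fullDomain Ω δ)))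
    (hul : MemLp ul 2 (volume.restrict (fullDomain Ω δ)))
    (hpoisson : ∀ᵐ x ∂volume.restrict Ω, -(nonlocalLaplacian γ un x) = s x)
    (he : e =ᵐ[volume.restrict (fullDomain Ω δ)] un - ul) :
    ∀ᵐ x ∂volume.restrict (fullDomain Ω δ), x ∈ Ω →
      |2 * ∫ y in fullDomain Ω δ, (e y - e x) * γ x y| ≤ η := by
  have := isFiniteMeasure_restrict_fullDomain hΩ_bdd hδ
  rw [ae_restrict_iff' hΩ_open.measurableSet] at hpoisson
  filter_upwards [he, ae_restrict_of_ae hpoisson] with x hx hp hxΩ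
  rw [integral_kernel_sub_of_ae_eq hun hul (hγ.memLp_two hxΩ) he hx,
    integral_fullDomain_eq hγ hδ hxΩ (fun y => un y - un x),
    integral_fullDomain_eq hγ hδ hxΩ (fun y => ul y - ul x)]
  have h1 := hcons x hxΩ
  have h2 := hp hxΩ
  rw [← h2] at h1
  unfold nonlocalLaplacian at h1
  rw [← abs_neg]
  convert h1 using 2
  ring

/-- The nonlocal Laplacian of the paraboloid `‖·‖²` is bounded below for small horizons. -/
theorem half_le_integral_norm_sq_sub {x : E d} {δ R K : ℝ} {g : E d → ℝ} (hd : 0 < d)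
    (hg : Integrable g) (hg_zero : ∀ y, δ ≤ ‖x - y‖ → g y = 0) (hR : 0 ≤ R)
    (hxR : ‖x‖ ≤ R)
    (h1 : ∀ i, |∫ y, (y - x) i * g y| ≤ K * δ ^ 2)
    (h2 : ∀ i j, |(∫ y, (y - x) i * (y - x) j * g y) - (if i = j then 1 else 0)| ≤ K * δ ^ 2)
    (hsmall : (K + 2 * R * K) * δ ^ 2 ≤ 1 / 2) :
    1 / 2 ≤ ∫ y, (‖y‖ ^ 2 - ‖x‖ ^ 2) * g y := by
  have hi1 : ∀ i, Integrable fun y => (y - x) i * g y := fun i => by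
    simpa using integrable_moment hg hg_zero ![i]
  -- This is `‖y‖² - ‖x‖² = ‖y - x‖² + 2 x·(y - x)`: the first term integrates to nearly `d`, the
  -- second is a small first moment.
  have hid : ∀ y : E d, (‖y‖ ^ 2 - ‖x‖ ^ 2) * g y =
      ‖y - x‖ ^ 2 * g y + ∑ i, 2 * x i * ((y - x) i * g y) := by
    intro y
    simp_rw [EuclideanSpace.norm_sq_eq, Real.norm_eq_abs, sq_abs]
    rw [← Finset.sum_sub_distrib, Finset.sum_mul, Finset.sum_mul, ← Finset.sum_add_distrib]
    refine Finset.sum_congr rfl fun i _ => ?_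
    simp only [PiLp.sub_apply]; ring
  simp_rw [hid]
  rw [integral_add (integrable_norm_sq_mul hg hg_zero)
    (integrable_finsetSum _ fun i _ => (hi1 i).const_mul _),
    integral_finsetSum _ fun i _ => (hi1 i).const_mul _]
  have hA := (abs_le.1 (abs_integral_norm_sq_mul_sub_le hg hg_zero h2)).1
  have hB : |∑ i, ∫ y, 2 * x i * ((y - x) i * g y)| ≤ d * (2 * R * (K * δ ^ 2)) := by
    refine (Finset.abs_sum_le_sum_abs _ _).trans ?_
    calc _ ≤ ∑ _i : Fin d, 2 * R * (K * δ ^ 2) := by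
          refine Finset.sum_le_sum fun i _ => ?_
          rw [integral_const_mul, abs_mul, abs_mul, abs_two]
          have : |x i| ≤ R := (PiLp.norm_apply_le x i).trans hxR
          gcongr
          exact h1 i
      _ = _ := by simp
  have hB' := (abs_le.1 hB).1
  have hd1 : (1 : ℝ) ≤ d := by exact_mod_cast hd
  nlinarith

/-- Compare `e` with the barrier `2η(R² - ‖x‖²)`, which is nonnegative on the full domain and so
dominates `e = 0` off `Ω`. -/
theorem ae_le_of_residual_le {Ω : Set (E d)} (hΩ_bdd : Bornology.IsBounded Ω)
    {δ R η : ℝ} (hδ : 0 < δ) (hη : 0 < η) {γ : E d → E d → ℝ} (hγ : IsIntegrableKernel Ω δ γ)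
    (hUR : fullDomain Ω δ ⊆ Metric.closedBall 0 R)
    (hbar : ∀ x ∈ Ω, 1 / 2 ≤ ∫ y, (‖y‖ ^ 2 - ‖x‖ ^ 2) * γ x y)
    {e : E d → ℝ} (he : Measurable e) (he2 : MemLp e 2 (volume.restrict (fullDomain Ω δ)))
    (he0 : ∀ x, x ∉ Ω → e x = 0)
    (hres : ∀ᵐ x ∂volume.restrict (fullDomain Ω δ), x ∈ Ω →
      |2 * ∫ y in fullDomain Ω δ, (e y - e x) * γ x y| ≤ η) :
    ∀ᵐ x ∂volume.restrict (fullDomain Ω δ), e x ≤ 2 * η * R ^ 2 := by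
  have := isFiniteMeasure_restrict_fullDomain hΩ_bdd hδ
  have hUm := measurableSet_fullDomain (Ω := Ω) hδ
  set U := fullDomain Ω δ with hU
  obtain ⟨Λ, -, hΛ⟩ := hγ.upper
  -- The factor `2η` makes the kernel integral of `b` at most `-η`, while that of `e` is at least
  -- `-η/2`. Thus `e - b` is a strict subsolution in `Ω`.
  set b : E d → ℝ := U.indicator fun x => 2 * η * (R ^ 2 - ‖x‖ ^ 2) with hb
  have hnorm : ∀ x ∈ U, ‖x‖ ^ 2 ≤ R ^ 2 := fun x hx => by
    have : ‖x‖ ≤ R := by simpa using hUR hx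
    gcongr
  have hbm : Measurable b := Measurable.indicator (by fun_prop) hUm
  have hb0 : ∀ x, 0 ≤ b x := indicator_nonneg fun x hx =>
    mul_nonneg (by positivity) (sub_nonneg.2 (hnorm x hx))
  have hbB : ∀ x, b x ≤ 2 * η * R ^ 2 := by
    intro x
    refine indicator_apply_le' (fun _ => ?_) fun _ => by positivity
    nlinarith [sq_nonneg ‖x‖, mul_nonneg hη.le (sq_nonneg ‖x‖)]
  have hb2 : MemLp b 2 (volume.restrict U) := by
    refine MemLp.of_bound hbm.aestronglyMeasurable (2 * η * R ^ 2) (Eventually.of_forall fun x => ?_)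
    rw [Real.norm_eq_abs, abs_of_nonneg (hb0 x)]
    exact hbB x
  have hstep : ∀ᵐ x ∂volume.restrict U, (e - b) x ≤ 0 := by
    refine ae_nonpos_of_strict_subsolution (S := Ω) (Λ := Λ) hγ.measurable hγ.nonneg hγ.symm hΛ
      (he.sub hbm) (he2.sub hb2) (fun x hx => ?_) ?_
    · simp [he0 x hx, hb0 x]
    · filter_upwards [hres] with x hx hxΩ
      have hk := hγ.memLp_two hxΩ
      rw [integral_kernel_sub_of_ae_eq he2 hb2 hk (Eventually.of_forall fun _ => rfl) rfl]
      have hbx : ∫ y in U, (b y - b x) * γ x y =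
          -(2 * η) * ∫ y, (‖y‖ ^ 2 - ‖x‖ ^ 2) * γ x y := by
        rw [← integral_fullDomain_eq hγ hδ hxΩ, ← integral_const_mul]
        refine setIntegral_congr_fun hUm fun y hy => ?_
        simp only [hb]
        rw [indicator_of_mem hy, indicator_of_mem (subset_fullDomain hxΩ)]
        ring
      rw [hbx]
      have h1 := (abs_le.1 (hx hxΩ)).1
      have h2 := hbar x hxΩ
      nlinarith
  filter_upwards [hstep] with x hx
  have := hbB x
  rw [Pi.sub_apply] at hx
  linarith

theorem exists_small_horizon (c : ℝ) {δ₀ : ℝ} (hδ₀ : 0 < δ₀) :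
    ∀ᶠ δ in 𝓝[>] (0 : ℝ), δ ∈ Ioc 0 δ₀ ∧ δ ≤ 1 ∧ c * δ ^ 2 ≤ 1 / 2 := by
  have h1 : ∀ᶠ δ in 𝓝[>] (0 : ℝ), δ ∈ Ioc 0 δ₀ := Ioc_mem_nhdsGT hδ₀
  have h2 : ∀ᶠ δ in 𝓝[>] (0 : ℝ), δ ∈ Ioc (0 : ℝ) 1 := Ioc_mem_nhdsGT one_pos
  have h3 : ∀ᶠ δ in 𝓝[>] (0 : ℝ), c * δ ^ 2 < 1 / 2 := by
    have : Tendsto (fun δ : ℝ => c * δ ^ 2) (𝓝[>] 0) (𝓝 (c * 0 ^ 2)) :=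
      ((by fun_prop : Continuous fun δ : ℝ => c * δ ^ 2).tendsto 0).mono_left nhdsWithin_le_nhds
    exact this.eventually_lt_const (by norm_num)
  filter_upwards [h1, h2, h3] with δ a b c using ⟨a, b.2, c.le⟩

/-- Dirichlet-to-Dirichlet coupling. -/
theorem dirichletToDirichlet_energy_error (hd : 0 < d)
    {Ω : Set (E d)} (hΩ_open : IsOpen Ω) (hΩ_bdd : Bornology.IsBounded Ω)
    {δ₀ : ℝ} (hδ₀ : 0 < δ₀) {γ : ℝ → E d → E d → ℝ}
    (hγ : ∀ δ ∈ Ioc 0 δ₀, IsIntegrableKernel Ω δ (γ δ))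
    (hγ_scale : ProperlyScaled Ω δ₀ γ)
    {Ωloc Ωnloc : ℝ → Set (E d)}
    (hsplit : ∀ δ ∈ Ioc 0 δ₀, IsSplitting Ω δ (Ωloc δ) (Ωnloc δ))
    {s v ul : ℝ → E d → ℝ}
    (hcd : ∀ δ ∈ Ioc 0 δ₀, ContDiffOn ℝ 4 (ul δ) (fullDomain Ω δ))
    (hpoisson : ∀ δ ∈ Ioc 0 δ₀, ∀ x ∈ fullDomain Ω δ, -(Laplacian.laplacian (ul δ) x) = s δ x)
    (hul_C4 : UniformlyC4 Ω δ₀ ul)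
    (hcompat : ∀ δ ∈ Ioc 0 δ₀, ∀ᵐ x ∂volume.restrict (Ωnloc δ), v δ x = ul δ x) :
    ∃ C : ℝ, ∀ᶠ δ in 𝓝[>] (0 : ℝ), ∀ un : E d → ℝ,
      IsDtDSolution Ω δ (Ωloc δ) (Ωnloc δ) (γ δ) (s δ) (v δ) (ul δ) un →
      energySeminorm (γ δ) (fullDomain Ω δ) (un - ul δ) ≤ ENNReal.ofReal (C * δ ^ 2) := by
  obtain ⟨C, hC, hcons⟩ := exists_consistency_bound hΩ_bdd hγ hγ_scale hcd hpoisson hul_C4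
  obtain ⟨K, hK⟩ := hγ_scale
  obtain ⟨M, hM⟩ := hul_C4
  obtain ⟨R, hR0, hR⟩ := (hΩ_bdd.thickening (δ := 1)).subset_closedBall_lt 0 0
  set V : ℝ := (volume (Metric.thickening 1 Ω)).toReal with hV
  have hV0 : 0 ≤ V := ENNReal.toReal_nonneg
  -- With `η = Cδ²`, the squared energy is at most the volume `V` times the sup bound `2ηR²` times
  -- the residual bound `η`.
  refine ⟨C * √(2 * R ^ 2 * V), ?_⟩
  filter_upwards [exists_small_horizon (|K| + 2 * R * |K|) hδ₀] with δ ⟨hδ, hδ1, hsmall⟩ un hun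
  have := isFiniteMeasure_restrict_fullDomain hΩ_bdd hδ.1
  have hk := hγ δ hδ
  have hUm := measurableSet_fullDomain (Ω := Ω) hδ.1
  have hU1 := fullDomain_subset_thickening_one (Ω := Ω) hδ.1 hδ1
  have hul2 : MemLp (ul δ) 2 (volume.restrict (fullDomain Ω δ)) :=
    memLp_two_of_uniformlyC4 hΩ_bdd hδ.1 (hcd δ hδ).continuousOn (hM δ hδ 0 (by norm_num))
  have hZm : MeasurableSet (interactionDomain Ω δ) := by
    rw [← (hsplit δ hδ).union_eq]
    exact (hsplit δ hδ).measurableSet_loc.union (hsplit δ hδ).measurableSet_nloc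
  have hZ : ∀ᵐ x ∂volume.restrict (interactionDomain Ω δ), un x = ul δ x := by
    rw [← (hsplit δ hδ).union_eq, ae_restrict_union_iff]
    refine ⟨hun.eq_loc, ?_⟩
    filter_upwards [hun.eq_nloc, hcompat δ hδ] with x h1 h2 using h1.trans h2
  obtain ⟨e, hem, he2, hee, he0⟩ := exists_error_representative hUm hZm hun.mem.1 hul2 hZ
  have he0' : ∀ x, x ∉ Ω → e x = 0 := fun x hx => he0 x fun hc => by
    rcases hc.1 with h | h
    · exact hx h
    · exact hc.2 h
  set η := C * δ ^ 2 with hη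
  have hδ2 : 0 < δ ^ 2 := pow_pos hδ.1 2
  have hη0 : 0 < η := by positivity
  have hres := ae_abs_residual_le hΩ_open hΩ_bdd hδ.1 hk (hcons δ hδ hδ1) hun.mem.1 hul2
    hun.poisson hee
  have hbar : ∀ x ∈ Ω, 1 / 2 ≤ ∫ y, (‖y‖ ^ 2 - ‖x‖ ^ 2) * γ δ x y := fun x hx => by
    obtain ⟨h1, h2, -⟩ := hK δ hδ x hx
    have hKδ : K * δ ^ 2 ≤ |K| * δ ^ 2 := by gcongr; exact le_abs_self K
    refine half_le_integral_norm_sq_sub hd (hk.integrable hΩ_bdd hδ.1 hx) (hk.eq_zero x hx)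
      hR0.le ?_ (fun i => (h1 i).trans hKδ) (fun i j => (h2 i j).trans hKδ) hsmall
    simpa using hR (hU1 (subset_fullDomain hx))
  have hup := ae_le_of_residual_le hΩ_bdd hδ.1 hη0 hk (hU1.trans hR) hbar hem he2 he0' hres
  have hlo := ae_le_of_residual_le (e := -e) hΩ_bdd hδ.1 hη0 hk (hU1.trans hR) hbar hem.neg
    he2.neg (fun x hx => by simp [he0' x hx]) (by
      filter_upwards [hres] with x hx hxΩ
      rw [← abs_neg]
      convert hx hxΩ using 2
      rw [← mul_neg, ← integral_neg]
      congr 2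
      funext y
      simp only [Pi.neg_apply]; ring)
  rw [energySeminorm_congr_ae hee]
  refine energySeminorm_le_of_lintegral_le (by positivity) ?_
  obtain ⟨Λ, -, hΛ⟩ := hk.upper
  refine (lintegral_energy_le_of_ae_bound (S := Ω) (Λ := Λ) (f := fun _ => 2 * η * R ^ 2 * η)
    hk.measurable hk.nonneg hk.symm hΛ hem he2 he0' (integrable_const _) ?_).trans ?_
  · filter_upwards [hup, hlo, hres] with x h1 h2 h3
    by_cases hx : x ∈ Ω
    · refine mul_le_mul (abs_le.2 ⟨?_, h1⟩) (h3 hx) (abs_nonneg _) (by positivity)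
      rw [Pi.neg_apply] at h2; linarith
    · rw [he0' x hx, abs_zero, zero_mul]; positivity
  · refine ENNReal.ofReal_le_ofReal ?_
    have hVle : (volume (fullDomain Ω δ)).toReal ≤ V :=
      ENNReal.toReal_mono (volume_thickening_one_lt_top hΩ_bdd).ne (measure_mono hU1)
    rw [integral_const, smul_eq_mul, measureReal_restrict_apply_univ]
    calc (volume (fullDomain Ω δ)).toReal * (2 * η * R ^ 2 * η)
        ≤ V * (2 * η * R ^ 2 * η) := by gcongr
      _ = (C * √(2 * R ^ 2 * V) * δ ^ 2) ^ 2 := by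
          rw [mul_pow, mul_pow, Real.sq_sqrt (by positivity), hη]; ring

/-! ### Discrete walks and chaining of increments. -/

/-- The squared nonlocal energy. -/
def energy (γ : E d → E d → ℝ) (U : Set (E d)) (u : E d → ℝ) : ℝ≥0∞ :=
  ∫⁻ x in U, ∫⁻ y in U, ENNReal.ofReal ((u y - u x) ^ 2 * γ x y)

/-- The squared increment of `u` by `z`, restricted to steps inside `U`. -/
def stepSq (U : Set (E d)) (u : E d → ℝ) (z x : E d) : ℝ≥0∞ :=
  U.indicator 1 x * U.indicator 1 (x + z) * ENNReal.ofReal ((u (x + z) - u x) ^ 2)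

section Steps

variable {U : Set (E d)} {u : E d → ℝ}

theorem measurable_stepSq (hU : MeasurableSet U) (hu : Measurable u) :
    Measurable fun q : E d × E d => stepSq U u q.1 q.2 := by
  have h1 : Measurable (U.indicator (1 : E d → ℝ≥0∞)) := measurable_one.indicator hU
  unfold stepSq
  fun_prop

/-- Tonelli and the substitution `y = x + z` turn the weighted step integral into a double integral
over `U × U`, where `ρ(‖y - x‖) ≤ γ(x,y)`. -/
theorem lintegral_radial_stepSq_le {γ : E d → E d → ℝ} {ρ : ℝ → ℝ} (hU : MeasurableSet U)
    (hu : Measurable u) (hρ : Measurable ρ)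
    (hργ : ∀ x ∈ U, ∀ y ∈ U, ρ ‖y - x‖ ≤ γ x y) :
    ∫⁻ z, ENNReal.ofReal (ρ ‖z‖) * ∫⁻ x, stepSq U u z x ≤ energy γ U u := by
  have hm := measurable_stepSq hU hu
  have hm' : Measurable fun q : E d × E d => ENNReal.ofReal (ρ ‖q.1‖) * stepSq U u q.1 q.2 := by
    fun_prop
  calc ∫⁻ z, ENNReal.ofReal (ρ ‖z‖) * ∫⁻ x, stepSq U u z x
      = ∫⁻ z, ∫⁻ x, ENNReal.ofReal (ρ ‖z‖) * stepSq U u z x := by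
        refine lintegral_congr fun z => ?_
        rw [lintegral_const_mul' _ _ ENNReal.ofReal_ne_top]
    _ = ∫⁻ x, ∫⁻ z, ENNReal.ofReal (ρ ‖z‖) * stepSq U u z x :=
        lintegral_lintegral_swap hm'.aemeasurable
    _ ≤ ∫⁻ x, U.indicator
          (fun x => ∫⁻ y in U, ENNReal.ofReal ((u y - u x) ^ 2 * γ x y)) x := by
        refine lintegral_mono fun x => ?_
        by_cases hx : x ∈ U
        · rw [indicator_of_mem hx]
          rw [← lintegral_indicator hU, ← lintegral_add_left_eq_self (U.indicator _) x]
          refine lintegral_mono fun z => ?_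
          by_cases hz : x + z ∈ U
          · rw [indicator_of_mem hz, stepSq, indicator_of_mem hx, indicator_of_mem hz]
            simp only [Pi.one_apply, one_mul]
            rw [mul_comm ((u (x + z) - u x) ^ 2),
              ENNReal.ofReal_mul' (sq_nonneg (u (x + z) - u x))]
            gcongr
            simpa using hργ x hx (x + z) hz
          · simp [stepSq, hz]
        · simp [stepSq, hx]
    _ = energy γ U u := lintegral_indicator hU _

/-- Telescoping along the walk followed by Cauchy-Schwarz. Every visited point lies in `U`, so no
indicator in `stepSq` vanishes. -/
theorem ofReal_sq_sub_le_sum_stepSq {x z : E d} {j : ℕ} (h : ∀ i ≤ j, x + i • z ∈ U) :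
    ENNReal.ofReal ((u (x + j • z) - u x) ^ 2) ≤
      j * ∑ i ∈ Finset.range j, stepSq U u z (x + i • z) := by
  have h1 : u (x + j • z) - u x =
      ∑ i ∈ Finset.range j, (u (x + (i + 1) • z) - u (x + i • z)) := by
    rw [Finset.sum_range_sub (fun i => u (x + i • z))]
    simp
  have h2 : (u (x + j • z) - u x) ^ 2 ≤
      j * ∑ i ∈ Finset.range j, (u (x + (i + 1) • z) - u (x + i • z)) ^ 2 := by
    rw [h1]
    simpa using sq_sum_le_card_mul_sum_sq (s := Finset.range j)
      (f := fun i => u (x + (i + 1) • z) - u (x + i • z))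
  refine (ENNReal.ofReal_le_ofReal h2).trans (le_of_eq ?_)
  rw [ENNReal.ofReal_mul (by positivity), ENNReal.ofReal_natCast,
    ENNReal.ofReal_sum_of_nonneg fun i _ => sq_nonneg _]
  congr 1
  refine Finset.sum_congr rfl fun i hi => ?_
  rw [Finset.mem_range] at hi
  have e1 : x + (i + 1) • z = x + i • z + z := by rw [add_smul, one_smul, add_assoc]
  have m1 := h i hi.le
  have m2 := h (i + 1) hi
  rw [e1] at m2
  rw [stepSq, indicator_of_mem m1, indicator_of_mem m2, e1]
  simp

/-- Chaining: if every point of `P` can be walked, by at most `k` steps `z` inside `U`, to a zero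
of `u` or, in exactly `k` steps, to `Q`, then the mass of `u` on `P` is controlled. -/
theorem lintegral_sq_le_of_walk {P Q : Set (E d)} {z : E d} {k : ℕ} (hU : MeasurableSet U)
    (hu : Measurable u) (hP : MeasurableSet P) (hQ : MeasurableSet Q)
    (hwalk : ∀ x ∈ P, ∃ j ≤ k, (∀ i ≤ j, x + i • z ∈ U) ∧
      (u (x + j • z) = 0 ∨ j = k ∧ x + k • z ∈ Q)) :
    ∫⁻ x in P, ENNReal.ofReal (u x ^ 2) ≤
      2 * (∫⁻ x in Q, ENNReal.ofReal (u x ^ 2)) + 2 * (k : ℝ≥0∞) ^ 2 * ∫⁻ x, stepSq U u z x := by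
  have hm := measurable_stepSq hU hu
  have hmz : Measurable fun x => stepSq U u z x := hm.comp (measurable_const.prodMk measurable_id)
  have hQm : Measurable (Q.indicator fun x => ENNReal.ofReal (u x ^ 2)) :=
    Measurable.indicator (by fun_prop) hQ
  have hpt : ∀ x ∈ P, ENNReal.ofReal (u x ^ 2) ≤
      2 * Q.indicator (fun x => ENNReal.ofReal (u x ^ 2)) (x + k • z) +
        2 * (k * ∑ i ∈ Finset.range k, stepSq U u z (x + i • z)) := by
    intro x hx
    obtain ⟨j, hjk, hj, hend⟩ := hwalk x hx
    have h1 : ENNReal.ofReal (u x ^ 2) ≤ 2 * ENNReal.ofReal (u (x + j • z) ^ 2) +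
        2 * ENNReal.ofReal ((u (x + j • z) - u x) ^ 2) := by
      have : ∀ t : ℝ, 2 * ENNReal.ofReal t = ENNReal.ofReal (2 * t) := fun t => by
        rw [ENNReal.ofReal_mul zero_le_two]; norm_num
      rw [this, this, ← ENNReal.ofReal_add (by positivity) (by positivity)]
      refine ENNReal.ofReal_le_ofReal ?_
      -- With `b` the value at the endpoint and `a` the value at `x`, `2b² + 2(b - a)² - a² = (2b -
      -- a)²`.
      nlinarith [sq_nonneg (2 * u (x + j • z) - u x)]
    refine h1.trans (add_le_add ?_ ?_)
    · gcongr
      rcases hend with h0 | ⟨rfl, hQx⟩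
      · simp [h0]
      · rw [indicator_of_mem hQx]
    · gcongr
      refine (ofReal_sq_sub_le_sum_stepSq hj).trans ?_
      gcongr
  calc ∫⁻ x in P, ENNReal.ofReal (u x ^ 2)
      ≤ ∫⁻ x in P, (2 * Q.indicator (fun x => ENNReal.ofReal (u x ^ 2)) (x + k • z) +
        2 * (k * ∑ i ∈ Finset.range k, stepSq U u z (x + i • z))) :=
        setLIntegral_mono' hP hpt
    _ ≤ ∫⁻ x, (2 * Q.indicator (fun x => ENNReal.ofReal (u x ^ 2)) (x + k • z) +
        2 * (k * ∑ i ∈ Finset.range k, stepSq U u z (x + i • z))) := setLIntegral_le_lintegral _ _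
    _ = _ := by
        rw [lintegral_add_left (by fun_prop), lintegral_const_mul _ (by fun_prop),
          lintegral_const_mul _ (by fun_prop), lintegral_const_mul _ (by fun_prop),
          lintegral_finsetSum _ (fun i _ => by fun_prop),
          lintegral_add_right_eq_self (Q.indicator fun x => ENNReal.ofReal (u x ^ 2)),
          lintegral_indicator hQ]
        simp_rw [lintegral_add_right_eq_self (fun x => stepSq U u z x)]
        simp only [Finset.sum_const, Finset.card_range, nsmul_eq_mul]
        ring

end Steps

theorem setLIntegral_biUnion_finset_le {X ι : Type*} [MeasurableSpace X] {μ : Measure X}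
    (F : Finset ι) (t : ι → Set X) (f : X → ℝ≥0∞) :
    ∫⁻ x in ⋃ i ∈ F, t i, f x ∂μ ≤ ∑ i ∈ F, ∫⁻ x in t i, f x ∂μ := by
  classical
  induction F using Finset.induction_on with
  | empty => simp
  | insert i F hi ih =>
    rw [Finset.set_biUnion_insert, Finset.sum_insert hi]
    exact (lintegral_union_le _ _ _).trans (add_le_add le_rfl ih)

/-! ### Averaging over a cone of directions. -/

section Cone

/-- The vectors whose direction is within `ε` of `a`. -/
def cone (a : E d) (ε : ℝ) : Set (E d) := {z | ‖z - ‖z‖ • a‖ < ε * ‖z‖}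

theorem measurableSet_cone (a : E d) (ε : ℝ) : MeasurableSet (cone a ε) :=
  (isOpen_lt (by fun_prop) (by fun_prop)).measurableSet

theorem lintegral_ball_inter_cone_eq {a b : E d} (hab : ‖a‖ = ‖b‖) (ε δ : ℝ) (h : ℝ → ℝ≥0∞) :
    ∫⁻ z in Metric.ball 0 δ ∩ cone b ε, h ‖z‖ = ∫⁻ z in Metric.ball 0 δ ∩ cone a ε, h ‖z‖ := by
  -- Reflection in the hyperplane orthogonal to `a - b` carries `a` to `b` and preserves norms and
  -- volume.
  set T := (Submodule.span ℝ {a - b})ᗮ.reflection with hT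
  have hTa : T a = b := Submodule.reflection_sub hab
  have hmp : MeasurePreserving T volume volume := T.measurePreserving
  have hpre : T ⁻¹' (Metric.ball 0 δ ∩ cone b ε) = Metric.ball 0 δ ∩ cone a ε := by
    ext z
    have : ‖T z - ‖z‖ • b‖ = ‖z - ‖z‖ • a‖ := by
      rw [← hTa, ← map_smul, ← map_sub, T.norm_map]
    simp [cone, this]
  have := hmp.setLIntegral_comp_preimage_emb T.toHomeomorph.measurableEmbedding
    (fun z => h ‖z‖) (Metric.ball 0 δ ∩ cone b ε)
  rw [hpre] at this
  simpa using this.symm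

/-- A cone carries a fixed fraction of every radial integral over a ball. -/
theorem exists_lintegral_ball_le_cone {a : E d} (ha : ‖a‖ = 1) {ε : ℝ} (hε : 0 < ε) :
    ∃ N : ℕ, ∀ (δ : ℝ) (h : ℝ → ℝ≥0∞), h 0 = 0 →
      ∫⁻ z in Metric.ball (0 : E d) δ, h ‖z‖ ≤ N * ∫⁻ z in Metric.ball 0 δ ∩ cone a ε, h ‖z‖ := by
  -- Finitely many cones of aperture `ε` cover all directions, and all carry the same radial
  -- integral; `N` is their number.
  obtain ⟨F, hFs, hF, hcov⟩ :=
    (isCompact_sphere (0 : E d) 1).finite_cover_balls hε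
  lift F to Finset (E d) using hF
  refine ⟨F.card, fun δ h h0 => ?_⟩
  calc ∫⁻ z in Metric.ball (0 : E d) δ, h ‖z‖
      ≤ ∫⁻ z in {0} ∪ ⋃ b ∈ F, Metric.ball 0 δ ∩ cone b ε, h ‖z‖ := by
        refine lintegral_mono_set fun z hz => ?_
        by_cases hz0 : z = 0
        · exact Or.inl hz0
        · right
          have hn : 0 < ‖z‖ := norm_pos_iff.2 hz0
          have hs : ‖z‖⁻¹ • z ∈ Metric.sphere (0 : E d) 1 := by
            simp [norm_smul, hn.ne']
          obtain ⟨b, hb, hzb⟩ := mem_iUnion₂.1 (hcov hs)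
          refine mem_iUnion₂.2 ⟨b, hb, hz, ?_⟩
          rw [Metric.mem_ball, dist_eq_norm] at hzb
          have : z - ‖z‖ • b = ‖z‖ • (‖z‖⁻¹ • z - b) := by
            rw [smul_sub, smul_smul, mul_inv_cancel₀ hn.ne', one_smul]
          change ‖z - ‖z‖ • b‖ < ε * ‖z‖
          rw [this, norm_smul, norm_norm, mul_comm]
          exact mul_lt_mul_of_pos_right hzb hn
    _ ≤ (∫⁻ z in ({0} : Set (E d)), h ‖z‖) +
          ∑ b ∈ F, ∫⁻ z in Metric.ball 0 δ ∩ cone b ε, h ‖z‖ := by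
        refine (lintegral_union_le _ _ _).trans ?_
        gcongr
        exact setLIntegral_biUnion_finset_le _ _ _
    _ = ∑ b ∈ F, ∫⁻ z in Metric.ball 0 δ ∩ cone a ε, h ‖z‖ := by
        rw [setLIntegral_congr_fun (measurableSet_singleton 0) (g := fun _ => 0)
          (fun z hz => by rw [mem_singleton_iff.1 hz, norm_zero, h0]), lintegral_zero, zero_add]
        refine Finset.sum_congr rfl fun b hb => ?_
        have : ‖b‖ = 1 := by simpa using hFs hb
        exact lintegral_ball_inter_cone_eq (ha.trans this.symm) ε δ h
    _ = _ := by simp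

/-- Integrate the bound for single steps against `ρ(‖z‖)` over the cone. The cone carries at least
`1/N` of the second moment, hence at least `m/N`, whatever the horizon. -/
theorem exists_energy_bound_of_cone_walk {a : E d} (ha : ‖a‖ = 1) {ε : ℝ} (hε : 0 < ε) {m : ℝ}
    (hm : 0 < m) {L : ℝ≥0∞} (hL : L ≠ ∞) :
    ∃ C : ℝ≥0∞, C ≠ ∞ ∧ ∀ (U : Set (E d)) (γ : E d → E d → ℝ) (ρ : ℝ → ℝ) (δ : ℝ) (u : E d → ℝ)
      (D : ℝ≥0∞), MeasurableSet U → Measurable u → Measurable ρ → (∀ t, 0 ≤ ρ t) →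
      (∀ x ∈ U, ∀ y ∈ U, ρ ‖y - x‖ ≤ γ x y) →
      ENNReal.ofReal m ≤ ∫⁻ z in Metric.ball (0 : E d) δ, ENNReal.ofReal (‖z‖ ^ 2 * ρ ‖z‖) →
      (∀ z ∈ Metric.ball 0 δ ∩ cone a ε,
        ENNReal.ofReal (‖z‖ ^ 2) * D ≤ L * ∫⁻ x, stepSq U u z x) →
      D ≤ C * energy γ U u := by
  obtain ⟨N, hN⟩ := exists_lintegral_ball_le_cone ha hε
  have hm0 : ENNReal.ofReal m ≠ 0 := by simpa using hm
  refine ⟨N * L / ENNReal.ofReal m, ENNReal.div_ne_top (ENNReal.mul_ne_top (by simp) hL) hm0, ?_⟩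
  intro U γ ρ δ u D hU hu hρ hρ0 hργ hmom hD
  have hmeas : Measurable fun z => ∫⁻ x, stepSq U u z x :=
    (measurable_stepSq hU hu).lintegral_prod_right'
  have h1 := hN δ (fun t => ENNReal.ofReal (t ^ 2 * ρ t)) (by simp)
  have h2 : (∫⁻ z in Metric.ball 0 δ ∩ cone a ε, ENNReal.ofReal (‖z‖ ^ 2 * ρ ‖z‖)) * D ≤
      L * energy γ U u := by
    calc (∫⁻ z in Metric.ball 0 δ ∩ cone a ε, ENNReal.ofReal (‖z‖ ^ 2 * ρ ‖z‖)) * D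
        = ∫⁻ z in Metric.ball 0 δ ∩ cone a ε, ENNReal.ofReal (‖z‖ ^ 2 * ρ ‖z‖) * D :=
          (lintegral_mul_const _ (by fun_prop)).symm
      _ ≤ ∫⁻ z in Metric.ball 0 δ ∩ cone a ε,
          L * (ENNReal.ofReal (ρ ‖z‖) * ∫⁻ x, stepSq U u z x) := by
          refine setLIntegral_mono' (measurableSet_ball.inter (measurableSet_cone a ε))
            fun z hz => ?_
          rw [ENNReal.ofReal_mul (by positivity)]
          calc _ = ENNReal.ofReal (ρ ‖z‖) * (ENNReal.ofReal (‖z‖ ^ 2) * D) := by ring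
            _ ≤ ENNReal.ofReal (ρ ‖z‖) * (L * ∫⁻ x, stepSq U u z x) :=
                mul_le_mul' le_rfl (hD z hz)
            _ = _ := by ring
      _ ≤ ∫⁻ z, L * (ENNReal.ofReal (ρ ‖z‖) * ∫⁻ x, stepSq U u z x) :=
          setLIntegral_le_lintegral _ _
      _ = L * ∫⁻ z, ENNReal.ofReal (ρ ‖z‖) * ∫⁻ x, stepSq U u z x :=
          lintegral_const_mul' _ _ hL
      _ ≤ _ := by gcongr; exact lintegral_radial_stepSq_le hU hu hρ hργ
  have h3 : ENNReal.ofReal m * D ≤ N * L * energy γ U u := by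
    calc ENNReal.ofReal m * D
        ≤ (N * ∫⁻ z in Metric.ball 0 δ ∩ cone a ε, ENNReal.ofReal (‖z‖ ^ 2 * ρ ‖z‖)) * D := by
          gcongr; exact hmom.trans h1
      _ = N * ((∫⁻ z in Metric.ball 0 δ ∩ cone a ε, ENNReal.ofReal (‖z‖ ^ 2 * ρ ‖z‖)) * D) := by
          ring
      _ ≤ N * (L * energy γ U u) := by gcongr
      _ = _ := by ring
  rw [ENNReal.div_eq_inv_mul, mul_assoc]
  rw [← ENNReal.div_eq_inv_mul, ENNReal.le_div_iff_mul_le (Or.inl hm0)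
    (Or.inl ENNReal.ofReal_ne_top), mul_comm]
  exact h3

end Cone

/-! ### Propagation of mass control along walks. -/

/-- For small horizons, the nonlocal energy controls the mass on `P` of functions vanishing on
`Z δ`, uniformly in `δ`. -/
def EnergyControls (Ω : Set (E d)) (γ : ℝ → E d → E d → ℝ) (Z : ℝ → Set (E d))
    (P : Set (E d)) : Prop :=
  ∃ C : ℝ≥0∞, C ≠ ∞ ∧ ∀ᶠ δ in 𝓝[>] (0 : ℝ), ∀ u : E d → ℝ, Measurable u →
    (∀ x ∈ Z δ, u x = 0) →
      ∫⁻ x in P, ENNReal.ofReal (u x ^ 2) ≤ C * energy (γ δ) (fullDomain Ω δ) u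

variable {Ω : Set (E d)} {γ : ℝ → E d → E d → ℝ} {Z : ℝ → Set (E d)} {P Q : Set (E d)}

theorem EnergyControls.empty : EnergyControls Ω γ Z ∅ :=
  ⟨0, by simp, Eventually.of_forall fun δ u _ _ => by simp⟩

theorem EnergyControls.mono (hPQ : P ⊆ Q) (hQ : EnergyControls Ω γ Z Q) :
    EnergyControls Ω γ Z P := by
  obtain ⟨C, hC, h⟩ := hQ
  refine ⟨C, hC, ?_⟩
  filter_upwards [h] with δ hδ u hu hZ
  exact (lintegral_mono_set hPQ).trans (hδ u hu hZ)

theorem EnergyControls.union (hP : EnergyControls Ω γ Z P) (hQ : EnergyControls Ω γ Z Q) :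
    EnergyControls Ω γ Z (P ∪ Q) := by
  obtain ⟨C, hC, h⟩ := hP
  obtain ⟨C', hC', h'⟩ := hQ
  refine ⟨C + C', ENNReal.add_ne_top.2 ⟨hC, hC'⟩, ?_⟩
  filter_upwards [h, h'] with δ hδ hδ' u hu hZ
  rw [add_mul]
  exact (lintegral_union_le _ _ _).trans (add_le_add (hδ u hu hZ) (hδ' u hu hZ))

/-- Take `k = ⌊‖w‖/‖z‖⌋`. The angular deviation accumulates to at most `ε/2`, and rounding costs
less than `‖z‖ < δ ≤ ε/2`. -/
theorem exists_nat_smul_near {w z : E d} {ε δ : ℝ} (hw : w ≠ 0) (hε : 0 < ε)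
    (hδε : δ ≤ ε / 2) (hz : z ∈ Metric.ball 0 δ ∩ cone (‖w‖⁻¹ • w) (ε / (2 * ‖w‖))) :
    ∃ k : ℕ, ‖k • z - w‖ < ε ∧ k * ‖z‖ ≤ ‖w‖ := by
  obtain ⟨hzδ, hzc⟩ := hz
  rw [mem_ball_zero_iff] at hzδ
  change ‖z - ‖z‖ • ‖w‖⁻¹ • w‖ < ε / (2 * ‖w‖) * ‖z‖ at hzc
  have hwn : 0 < ‖w‖ := norm_pos_iff.2 hw
  have hzn : 0 < ‖z‖ := by
    by_contra h
    have h0 : ‖z‖ = 0 := le_antisymm (not_lt.1 h) (norm_nonneg z)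
    rw [h0, mul_zero] at hzc
    exact absurd hzc (not_lt.2 (norm_nonneg _))
  set k := ⌊‖w‖ / ‖z‖⌋₊ with hk
  have h1 : (k : ℝ) * ‖z‖ ≤ ‖w‖ := by
    have := Nat.floor_le (show 0 ≤ ‖w‖ / ‖z‖ by positivity)
    rwa [le_div_iff₀ hzn] at this
  have h2 : ‖w‖ < k * ‖z‖ + ‖z‖ := by
    have := Nat.lt_floor_add_one (‖w‖ / ‖z‖)
    rw [div_lt_iff₀ hzn] at this
    linarith
  refine ⟨k, ?_, h1⟩
  have hdec : k • z - w = (k : ℝ) • (z - ‖z‖ • ‖w‖⁻¹ • w) -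
      (‖w‖ - k * ‖z‖) • ‖w‖⁻¹ • w := by
    rw [smul_sub, smul_smul, sub_smul, smul_smul ‖w‖, mul_inv_cancel₀ hwn.ne', one_smul,
      Nat.cast_smul_eq_nsmul]
    abel
  have hunit : ‖‖w‖⁻¹ • w‖ = 1 := by simp [norm_smul, hwn.ne']
  rw [hdec]
  refine (norm_sub_le _ _).trans_lt ?_
  rw [norm_smul, norm_smul, hunit, mul_one, Real.norm_natCast, Real.norm_eq_abs,
    abs_of_nonneg (by linarith)]
  have h3 : (k : ℝ) * ‖z - ‖z‖ • ‖w‖⁻¹ • w‖ ≤ ε / 2 := by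
    calc _ ≤ (k : ℝ) * (ε / (2 * ‖w‖) * ‖z‖) := by gcongr
      _ = ε / (2 * ‖w‖) * (k * ‖z‖) := by ring
      _ ≤ ε / (2 * ‖w‖) * ‖w‖ := by gcongr
      _ = ε / 2 := by field_simp
  linarith

/-- Control propagates along discrete walks in directions close to `w`. -/
theorem EnergyControls.of_walk {δ₀ : ℝ} (hδ₀ : 0 < δ₀) (hdom : DominatesRadial Ω δ₀ γ)
    (hP : MeasurableSet P) (hQ : MeasurableSet Q) (hQc : EnergyControls Ω γ Z Q)
    {w : E d} (hw : w ≠ 0) {ε : ℝ} (hε : 0 < ε)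
    (hwalk : ∀ δ ∈ Ioc 0 δ₀, ∀ z ∈ Metric.ball (0 : E d) δ, ∀ k : ℕ, ‖k • z - w‖ < ε → ∀ x ∈ P,
      ∃ j ≤ k, (∀ i ≤ j, x + i • z ∈ fullDomain Ω δ) ∧
        (x + j • z ∈ Z δ ∨ j = k ∧ x + k • z ∈ Q)) : EnergyControls Ω γ Z P := by
  obtain ⟨m, hm, ρ, hρ⟩ := hdom
  obtain ⟨CQ, hCQ, hQc⟩ := hQc
  have hwn : 0 < ‖w‖ := norm_pos_iff.2 hw
  obtain ⟨C, hC, hCE⟩ := exists_energy_bound_of_cone_walk (a := ‖w‖⁻¹ • w)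
    (ε := ε / (2 * ‖w‖)) (by simp [norm_smul, hwn.ne']) (by positivity) hm
    (L := 2 * ENNReal.ofReal (‖w‖ ^ 2)) (ENNReal.mul_ne_top (by simp) ENNReal.ofReal_ne_top)
  refine ⟨2 * CQ + C, ENNReal.add_ne_top.2 ⟨ENNReal.mul_ne_top (by simp) hCQ, hC⟩, ?_⟩
  have hs1 : ∀ᶠ δ in 𝓝[>] (0 : ℝ), δ ∈ Ioc 0 δ₀ := Ioc_mem_nhdsGT hδ₀
  have hs2 : ∀ᶠ δ in 𝓝[>] (0 : ℝ), δ ∈ Ioc 0 (ε / 2) := Ioc_mem_nhdsGT (by positivity)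
  filter_upwards [hQc, hs1, hs2] with δ hQδ hδ hδε u hu hZ
  obtain ⟨hρm, hρ0, hργ, hmom⟩ := hρ δ hδ
  have hU := measurableSet_fullDomain (Ω := Ω) hδ.1
  set IP := ∫⁻ x in P, ENNReal.ofReal (u x ^ 2)
  set IQ := ∫⁻ x in Q, ENNReal.ofReal (u x ^ 2)
  -- Truncated subtraction isolates the part of the mass not already controlled on `Q`, with no
  -- finiteness assumption on `IP` or `IQ`. The factor `2‖w‖²` comes from `2k²‖z‖² ≤ 2‖w‖²`.
  have hD : IP - 2 * IQ ≤ C * energy (γ δ) (fullDomain Ω δ) u := by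
    refine hCE _ _ (ρ δ) δ u _ hU hu hρm hρ0 hργ hmom fun z hz => ?_
    obtain ⟨k, hk1, hk2⟩ := exists_nat_smul_near hw hε hδε.2 hz
    have hle := lintegral_sq_le_of_walk (k := k) hU hu hP hQ fun x hx => by
      obtain ⟨j, hj, hin, hend⟩ := hwalk δ hδ z hz.1 k hk1 x hx
      exact ⟨j, hj, hin, hend.imp_left (hZ _)⟩
    calc ENNReal.ofReal (‖z‖ ^ 2) * (IP - 2 * IQ)
        ≤ ENNReal.ofReal (‖z‖ ^ 2) *
          (2 * (k : ℝ≥0∞) ^ 2 * ∫⁻ x, stepSq (fullDomain Ω δ) u z x) := by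
          gcongr
          exact tsub_le_iff_left.2 hle
      _ = 2 * (ENNReal.ofReal ((k * ‖z‖) ^ 2)) * ∫⁻ x, stepSq (fullDomain Ω δ) u z x := by
          rw [mul_pow, ENNReal.ofReal_mul (by positivity),
            ENNReal.ofReal_pow (Nat.cast_nonneg k), ENNReal.ofReal_natCast]
          ring
      _ ≤ _ := by gcongr
  calc IP ≤ 2 * IQ + (IP - 2 * IQ) := le_add_tsub
    _ ≤ 2 * (CQ * energy (γ δ) (fullDomain Ω δ) u) + C * energy (γ δ) (fullDomain Ω δ) u := by
        gcongr
        exact hQδ u hu hZ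
    _ = _ := by ring

theorem add_nsmul_mem_of_segment_subset {x z : E d} {k i : ℕ} {S : Set (E d)} (hi : i ≤ k)
    (h : ∀ t ∈ Icc (0 : ℝ) 1, x + t • (k • z) ∈ S) : x + i • z ∈ S := by
  rcases Nat.eq_zero_or_pos k with rfl | hk
  · obtain rfl : i = 0 := by omega
    simpa using h 0 (by simp)
  · have hk' : (0 : ℝ) < k := by exact_mod_cast hk
    have := h (i / k) ⟨by positivity, by
      rw [div_le_one hk']; exact_mod_cast hi⟩
    rwa [← Nat.cast_smul_eq_nsmul ℝ k, smul_smul, div_mul_cancel₀ _ hk'.ne',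
      Nat.cast_smul_eq_nsmul] at this

/-- Control propagates from `Q` to `P` if translations near `w` carry `P` into `Q` through `Ω`. -/
theorem EnergyControls.of_translate {δ₀ : ℝ} (hδ₀ : 0 < δ₀) (hdom : DominatesRadial Ω δ₀ γ)
    (hP : MeasurableSet P) (hQ : MeasurableSet Q) (hQc : EnergyControls Ω γ Z Q)
    {w : E d} (hw : w ≠ 0) {ε : ℝ} (hε : 0 < ε)
    (hseg : ∀ x ∈ P, ∀ w', ‖w' - w‖ < ε → (∀ t ∈ Icc (0 : ℝ) 1, x + t • w' ∈ Ω) ∧ x + w' ∈ Q) :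
    EnergyControls Ω γ Z P := by
  refine EnergyControls.of_walk hδ₀ hdom hP hQ hQc hw hε fun δ _ z _ k hk x hx => ?_
  obtain ⟨h1, h2⟩ := hseg x hx (k • z) hk
  exact ⟨k, le_rfl, fun i hi => subset_fullDomain (add_nsmul_mem_of_segment_subset hi h1),
    Or.inr ⟨rfl, h2⟩⟩

/-- Control on sets that are carried out of `Ω` through the layer where functions vanish. -/
theorem EnergyControls.of_exit {δ₀ : ℝ} (hδ₀ : 0 < δ₀) (hdom : DominatesRadial Ω δ₀ γ)
    {x₀ : E d} {r : ℝ} (hZ : ∀ δ ∈ Ioc 0 δ₀, interactionDomain Ω δ ∩ Metric.ball x₀ r ⊆ Z δ)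
    (hP : MeasurableSet P) (hPΩ : P ⊆ Ω) (hPr : P ⊆ Metric.ball x₀ r)
    {w : E d} (hw : w ≠ 0) {ε : ℝ} (hε : 0 < ε)
    (hout : ∀ x ∈ P, ∀ w', ‖w' - w‖ < ε → x + w' ∉ Ω ∧ x + w' ∈ Metric.ball x₀ r) :
    EnergyControls Ω γ Z P := by
  classical
  refine EnergyControls.of_walk hδ₀ hdom hP MeasurableSet.empty EnergyControls.empty hw hε
    fun δ hδ z hz k hk x hx => ?_
  obtain ⟨h1, h2⟩ := hout x hx (k • z) hk
  -- Stop at the first exit. The preceding point is in `Ω` at distance less than `δ`, so the exit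
  -- point lies in the interaction layer; convexity keeps it in the ball about `x₀`, hence in `Z δ`.
  have hex : ∃ j : ℕ, x + j • z ∉ Ω := ⟨k, h1⟩
  have hjk : Nat.find hex ≤ k := Nat.find_min' hex h1
  have hj : x + Nat.find hex • z ∉ Ω := Nat.find_spec hex
  have hlt : ∀ i < Nat.find hex, x + i • z ∈ Ω := fun i hi => not_not.1 (Nat.find_min hex hi)
  have hj0 : Nat.find hex ≠ 0 := fun h => by
    rw [h] at hj
    exact hj (by simpa using hPΩ hx)
  obtain ⟨l, hl⟩ := Nat.exists_eq_succ_of_ne_zero hj0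
  have hI : x + Nat.find hex • z ∈ interactionDomain Ω δ := by
    refine ⟨hj, x + l • z, hlt l (by omega), ?_⟩
    rw [hl, Nat.succ_eq_add_one, add_smul, one_smul]
    simpa using hz
  refine ⟨Nat.find hex, hjk, fun i hi => ?_, Or.inl (hZ δ hδ ⟨hI, ?_⟩)⟩
  · rcases hi.lt_or_eq with h | h
    · exact subset_fullDomain (hlt i h)
    · rw [h]; exact Or.inr hI
  · refine add_nsmul_mem_of_segment_subset hjk fun t ht => ?_
    have := (convex_ball x₀ r).add_smul_sub_mem (hPr hx) h2 ht
    simpa using this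

/-! ### Exterior balls and interior cones of Lipschitz domains. -/

/-- The exterior of a Lipschitz domain accumulates at every boundary point. -/
theorem HasLipschitzBoundary.exists_exterior_ball (hΩ_open : IsOpen Ω)
    (hΩ : HasLipschitzBoundary Ω) {x₀ : E d} (hx₀ : x₀ ∈ frontier Ω) {r : ℝ} (hr : 0 < r) :
    ∃ q ∈ Metric.ball x₀ r, ∃ ε > 0, Metric.ball q ε ⊆ Ωᶜ := by
  obtain ⟨r₁, hr₁, ν, hν, K, g, hg, hiff⟩ := hΩ x₀ hx₀
  have hx₀Ω : x₀ ∉ Ω := by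
    rw [hΩ_open.frontier_eq] at hx₀
    exact hx₀.2
  have h0 : inner ℝ ν x₀ ≤ g (x₀ - inner ℝ ν x₀ • ν) := by
    by_contra h
    exact hx₀Ω ((hiff x₀ (Metric.mem_ball_self hr₁)).2 (not_le.1 h))
  set s := min r r₁ / 2 with hs
  have hs0 : 0 < s := by positivity
  have hsr : s < min r r₁ := half_lt_self (by positivity)
  have hνν : inner ℝ ν ν = (1 : ℝ) := by rw [real_inner_self_eq_norm_sq, hν, one_pow]
  have hqd : dist (x₀ - s • ν) x₀ = s := by
    rw [dist_eq_norm]; simp [norm_smul, hν, abs_of_pos hs0]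
  -- Moving along `ν` leaves the argument of `g` unchanged, so a step down from a point not above
  -- the graph lands strictly below it.
  have hproj : (x₀ - s • ν) - inner ℝ ν (x₀ - s • ν) • ν = x₀ - inner ℝ ν x₀ • ν := by
    rw [inner_sub_right, inner_smul_right, hνν, sub_smul, mul_one]; abel
  have hopen : IsOpen (Metric.ball x₀ r₁ ∩
      {y | inner ℝ ν y < g (y - inner ℝ ν y • ν)}) := by
    refine Metric.isOpen_ball.inter (isOpen_lt (by fun_prop) ?_)
    exact hg.continuous.comp (by fun_prop)
  have hmem : x₀ - s • ν ∈ Metric.ball x₀ r₁ ∩ {y | inner ℝ ν y < g (y - inner ℝ ν y • ν)} := by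
    refine ⟨?_, ?_⟩
    · rw [Metric.mem_ball, hqd]; exact hsr.trans_le (min_le_right _ _)
    · change inner ℝ ν (x₀ - s • ν) < g _
      rw [hproj, inner_sub_right, inner_smul_right, hνν]
      linarith
  obtain ⟨ε, hε, hball⟩ := Metric.isOpen_iff.1 hopen _ hmem
  refine ⟨x₀ - s • ν, ?_, ε, hε, fun y hy hyΩ => ?_⟩
  · rw [Metric.mem_ball, hqd]; exact hsr.trans_le (min_le_left _ _)
  · have := hball hy
    exact absurd ((hiff y this.1).1 hyΩ) (not_lt.2 this.2.le)

/-- Interior cone condition at the boundary points of a Lipschitz domain. -/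
theorem HasLipschitzBoundary.exists_interior_cone (hΩ : HasLipschitzBoundary Ω) {x₀ : E d}
    (hx₀ : x₀ ∈ frontier Ω) :
    ∃ w : E d, w ≠ 0 ∧ ∃ ε > 0, ∀ x ∈ Ω ∩ Metric.ball x₀ ε, ∀ w', ‖w' - w‖ < ε →
      ∀ t ∈ Icc (0 : ℝ) 1, x + t • w' ∈ Ω := by
  obtain ⟨r, hr, ν, hν, K, g, hg, hiff⟩ := hΩ x₀ hx₀
  have hν0 : ν ≠ 0 := by rintro rfl; simp at hν
  have hνν : inner ℝ ν ν = (1 : ℝ) := by rw [real_inner_self_eq_norm_sq, hν, one_pow]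
  set l := r / 4 with hl
  have hl0 : 0 < l := by positivity
  -- A deviation `v` of `w'` from `lν` lowers the height by at most `‖v‖` and raises the graph by at
  -- most `2K‖v‖`, both scaled by `t`; `ε(1 + 2K) = l` compensates. The choice `l = r/4` keeps the
  -- segment in the chart.
  set ε := l / (1 + 2 * K) with hε
  have hK0 : (0 : ℝ) ≤ K := K.2
  have hε0 : 0 < ε := by positivity
  have hεl : ε * (1 + 2 * K) = l := by rw [hε]; field_simp
  have hεl' : ε ≤ l := by nlinarith
  refine ⟨l • ν, smul_ne_zero hl0.ne' hν0, ε, hε0, fun x hx w' hw' t ht => ?_⟩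
  have hw'n : ‖w'‖ < ε + l := by
    calc ‖w'‖ = ‖(w' - l • ν) + l • ν‖ := by rw [sub_add_cancel]
      _ ≤ ‖w' - l • ν‖ + ‖l • ν‖ := norm_add_le _ _
      _ < ε + l := by
        rw [norm_smul, hν, mul_one, Real.norm_eq_abs, abs_of_pos hl0]; linarith
  have hxd := hx.2
  rw [Metric.mem_ball, dist_eq_norm] at hxd
  have hxb : x ∈ Metric.ball x₀ r := by
    rw [Metric.mem_ball, dist_eq_norm]; linarith
  have htw : ‖t • w'‖ ≤ ‖w'‖ := by
    rw [norm_smul, Real.norm_eq_abs, abs_of_nonneg ht.1]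
    exact mul_le_of_le_one_left (norm_nonneg _) ht.2
  have hyb : x + t • w' ∈ Metric.ball x₀ r := by
    rw [Metric.mem_ball, dist_eq_norm]
    calc ‖x + t • w' - x₀‖ = ‖(x - x₀) + t • w'‖ := by congr 1; abel
      _ ≤ ‖x - x₀‖ + ‖t • w'‖ := norm_add_le _ _
      _ < r := by linarith
  rw [hiff _ hyb]
  have hgx := (hiff x hxb).1 hx.1
  set v := w' - l • ν with hv
  have hin : inner ℝ ν w' = l + inner ℝ ν v := by
    rw [hv, inner_sub_right, inner_smul_right, hνν]; ring
  have hvb : |inner ℝ ν v| ≤ ‖v‖ := by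
    simpa [hν] using abs_real_inner_le_norm ν v
  have hproj : (x + t • w') - inner ℝ ν (x + t • w') • ν - (x - inner ℝ ν x • ν) =
      t • (v - inner ℝ ν v • ν) := by
    rw [inner_add_right, inner_smul_right, hin, hv]
    module
  have hpn : ‖t • (v - inner ℝ ν v • ν)‖ ≤ t * (2 * ‖v‖) := by
    rw [norm_smul, Real.norm_eq_abs, abs_of_nonneg ht.1]
    refine mul_le_mul_of_nonneg_left ?_ ht.1
    refine (norm_sub_le _ _).trans ?_
    rw [norm_smul, hν, mul_one, Real.norm_eq_abs]
    linarith
  have hlip := hg.dist_le_mul ((x + t • w') - inner ℝ ν (x + t • w') • ν) (x - inner ℝ ν x • ν)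
  rw [dist_eq_norm, dist_eq_norm, hproj, Real.norm_eq_abs] at hlip
  have h1 := (abs_le.1 hlip).2
  have h2 : K * ‖t • (v - inner ℝ ν v • ν)‖ ≤ K * (t * (2 * ‖v‖)) :=
    mul_le_mul_of_nonneg_left hpn hK0
  have h3 := (abs_le.1 hvb).1
  have h4 : 0 ≤ t * (l + inner ℝ ν v - K * (2 * ‖v‖)) := by
    refine mul_nonneg ht.1 ?_
    nlinarith [mul_le_mul_of_nonneg_left hw'.le hK0]
  rw [inner_add_right, inner_smul_right, hin] at *
  nlinarith

/-! ### Uniform nonlocal Poincaré inequality. -/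

/-- Points with a neighbourhood on which the mass is controlled. -/
def controlledPoints (Ω : Set (E d)) (γ : ℝ → E d → E d → ℝ) (Z : ℝ → Set (E d)) : Set (E d) :=
  {p | ∃ η > 0, EnergyControls Ω γ Z (Metric.ball p η)}

theorem isOpen_controlledPoints : IsOpen (controlledPoints Ω γ Z) := by
  rw [Metric.isOpen_iff]
  rintro p ⟨η, hη, h⟩
  refine ⟨η / 2, by positivity, fun q hq => ⟨η / 2, by positivity, h.mono ?_⟩⟩
  refine Metric.ball_subset_ball' ?_
  rw [Metric.mem_ball] at hq
  linarith

/-- Near `p` there is a controlled `q`. Translations close to `q - p` carry a small ball about `p`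
into the controlled ball about `q`, inside a ball contained in `Ω`. -/
theorem controlledPoints_of_closure {δ₀ : ℝ} (hδ₀ : 0 < δ₀) (hdom : DominatesRadial Ω δ₀ γ)
    (hΩ_open : IsOpen Ω) :
    closure (controlledPoints Ω γ Z) ∩ Ω ⊆ controlledPoints Ω γ Z := by
  rintro p ⟨hpc, hpΩ⟩
  obtain ⟨R, hR, hball⟩ := Metric.isOpen_iff.1 hΩ_open p hpΩ
  obtain ⟨q, hq, hpq⟩ := Metric.mem_closure_iff.1 hpc (R / 2) (by positivity)
  by_cases hne : q = p
  · rwa [← hne]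
  obtain ⟨η, hη, hc⟩ := hq
  set τ := min η R / 4 with hτ
  have hm : 0 < min η R := lt_min hη hR
  have hτ0 : 0 < τ := by positivity
  have hτη : 4 * τ ≤ η := by rw [hτ]; linarith [min_le_left η R]
  have hτR : 4 * τ ≤ R := by rw [hτ]; linarith [min_le_right η R]
  refine ⟨τ, hτ0, EnergyControls.of_translate hδ₀ hdom measurableSet_ball measurableSet_ball hc
    (sub_ne_zero.2 hne) hτ0 fun x hx w' hw' => ?_⟩
  rw [Metric.mem_ball, dist_eq_norm] at hx
  have hend : ‖x + w' - q‖ < 2 * τ := by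
    calc ‖x + w' - q‖ = ‖(x - p) + (w' - (q - p))‖ := by congr 1; abel
      _ ≤ ‖x - p‖ + ‖w' - (q - p)‖ := norm_add_le _ _
      _ < 2 * τ := by linarith
  refine ⟨fun t ht => hball ?_, ?_⟩
  · have h1 : x ∈ Metric.ball p R := by rw [Metric.mem_ball, dist_eq_norm]; linarith
    have h2 : x + w' ∈ Metric.ball p R := by
      rw [Metric.mem_ball]
      have := dist_triangle (x + w') q p
      rw [dist_eq_norm (x + w') q] at this
      rw [dist_comm] at hpq
      linarith
    simpa using (convex_ball p R).add_smul_sub_mem h1 h2 ht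
  · rw [Metric.mem_ball, dist_eq_norm]; linarith

/-- Near `x₀` choose `p` in `Ω` and `q` in the exterior. Translations close to `q - p` push a ball
about `p` out of `Ω` while staying where the layer belongs to `Z δ`. -/
theorem exists_controlledPoint {δ₀ : ℝ} (hδ₀ : 0 < δ₀) (hdom : DominatesRadial Ω δ₀ γ)
    (hΩ_open : IsOpen Ω) (hΩ_lip : HasLipschitzBoundary Ω)
    (hport : ContainsBoundaryPortion Ω δ₀ Z) : (Ω ∩ controlledPoints Ω γ Z).Nonempty := by
  obtain ⟨x₀, hx₀, r, hr, hZ⟩ := hport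
  obtain ⟨q, hq, ε₁, hε₁, hext⟩ :=
    hΩ_lip.exists_exterior_ball hΩ_open hx₀ (r := r / 2) (by positivity)
  obtain ⟨p, hpΩ, hp⟩ := Metric.mem_closure_iff.1 (frontier_subset_closure hx₀) (r / 2)
    (by positivity)
  obtain ⟨ε₂, hε₂, h_inner⟩ := Metric.isOpen_iff.1 hΩ_open p hpΩ
  have hne : q ≠ p := by
    rintro rfl
    exact hext (Metric.mem_ball_self hε₁) hpΩ
  rw [Metric.mem_ball] at hq
  rw [dist_comm] at hp
  set ε := min (min ε₁ ε₂) (r / 2) / 2 with hε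
  have hε0 : 0 < ε := by positivity
  have hm : 2 * ε = min (min ε₁ ε₂) (r / 2) := by rw [hε]; ring
  have h1 : 2 * ε ≤ ε₁ := hm.le.trans ((min_le_left _ _).trans (min_le_left _ _))
  have h2 : 2 * ε ≤ ε₂ := hm.le.trans ((min_le_left _ _).trans (min_le_right _ _))
  have h3 : 2 * ε ≤ r / 2 := hm.le.trans (min_le_right _ _)
  refine ⟨p, hpΩ, ε, hε0, EnergyControls.of_exit hδ₀ hdom hZ measurableSet_ball ?_ ?_
    (sub_ne_zero.2 hne) hε0 fun x hx w' hw' => ?_⟩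
  · exact (Metric.ball_subset_ball (by linarith)).trans h_inner
  · exact Metric.ball_subset_ball' (by linarith)
  · rw [Metric.mem_ball, dist_eq_norm] at hx
    have hend : dist (x + w') q < 2 * ε := by
      rw [dist_eq_norm]
      calc ‖x + w' - q‖ = ‖(x - p) + (w' - (q - p))‖ := by congr 1; abel
        _ ≤ ‖x - p‖ + ‖w' - (q - p)‖ := norm_add_le _ _
        _ < 2 * ε := by linarith
    refine ⟨hext (Metric.mem_ball.2 (by linarith)), ?_⟩
    rw [Metric.mem_ball]
    linarith [dist_triangle (x + w') q x₀]

/-- Nonlocal Poincaré inequality, uniform in the horizon. -/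
theorem energyControls_domain {δ₀ : ℝ} (hδ₀ : 0 < δ₀) (hdom : DominatesRadial Ω δ₀ γ)
    (hΩ_open : IsOpen Ω) (hΩ_conn : IsConnected Ω) (hΩ_bdd : Bornology.IsBounded Ω)
    (hΩ_lip : HasLipschitzBoundary Ω) (hport : ContainsBoundaryPortion Ω δ₀ Z) :
    EnergyControls Ω γ Z Ω := by
  have hall : Ω ⊆ controlledPoints Ω γ Z :=
    hΩ_conn.isPreconnected.subset_of_closure_inter_subset isOpen_controlledPoints
      (exists_controlledPoint hδ₀ hdom hΩ_open hΩ_lip hport)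
      (controlledPoints_of_closure hδ₀ hdom hΩ_open)
  have hcomp : IsCompact (closure Ω) := hΩ_bdd.isCompact_closure
  have key : EnergyControls Ω γ Z (Ω ∩ closure Ω) := by
    refine hcomp.induction_on (p := fun S => EnergyControls Ω γ Z (Ω ∩ S)) ?_ ?_ ?_ ?_
    · simpa using EnergyControls.empty
    · exact fun S T hST hT => hT.mono (inter_subset_inter_right _ hST)
    · intro S T hS hT
      rw [inter_union_distrib_left]
      exact hS.union hT
    · intro x hx
      by_cases hxΩ : x ∈ Ω
      · obtain ⟨η, hη, h⟩ := hall hxΩ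
        exact ⟨Metric.ball x η, mem_nhdsWithin_of_mem_nhds (Metric.ball_mem_nhds x hη),
          h.mono inter_subset_right⟩
      · have hfr : x ∈ frontier Ω := by
          rw [hΩ_open.frontier_eq]; exact ⟨hx, hxΩ⟩
        obtain ⟨w, hw, ε, hε, hcone⟩ := hΩ_lip.exists_interior_cone hfr
        obtain ⟨y, hyΩ, hy⟩ := Metric.mem_closure_iff.1 hx ε hε
        -- The cone condition starts at points of `Ω`, not at `x` itself: apply it at a nearby `y ∈
        -- Ω` with the translation `x + w - y`, which is `ε`-close to `w`.
        have hxw : x + w ∈ Ω := by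
          have := hcone y ⟨hyΩ, by rwa [Metric.mem_ball, dist_comm]⟩ (x + w - y) (by
            rw [dist_eq_norm] at hy
            rwa [show x + w - y - w = x - y by abel]) 1 (by simp)
          simpa using this
        obtain ⟨η, hη, h⟩ := hall hxw
        set τ := min ε (η / 2) with hτ
        have hτ0 : 0 < τ := by positivity
        refine ⟨Metric.ball x τ, mem_nhdsWithin_of_mem_nhds (Metric.ball_mem_nhds x hτ0), ?_⟩
        refine EnergyControls.of_translate hδ₀ hdom
          (hΩ_open.measurableSet.inter measurableSet_ball) measurableSet_ball h hw hτ0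
          fun z hz w' hw' => ⟨?_, ?_⟩
        · exact hcone z ⟨hz.1, Metric.ball_subset_ball (min_le_left _ _) hz.2⟩ w'
            (hw'.trans_le (min_le_left _ _))
        · have hzx := hz.2
          rw [Metric.mem_ball, dist_eq_norm] at hzx ⊢
          have hτη : τ ≤ η / 2 := min_le_right _ _
          calc ‖z + w' - (x + w)‖ = ‖(z - x) + (w' - w)‖ := by congr 1; abel
            _ ≤ ‖z - x‖ + ‖w' - w‖ := norm_add_le _ _
            _ < η := by linarith
  exact key.mono (subset_inter subset_rfl subset_closure)

/-! ### Absorption and the Dirichlet-to-Neumann estimate. -/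

/-- Absorbing the mass into the energy. -/
theorem energy_le_of_residual_le {Ω S : Set (E d)} (hΩ_open : IsOpen Ω)
    (hΩ_bdd : Bornology.IsBounded Ω) {δ η V c Λ : ℝ} (hδ : 0 < δ) (hc : 0 < c)
    (hV : (volume (fullDomain Ω δ)).toReal ≤ V)
    {γ : E d → E d → ℝ} (hγ : IsIntegrableKernel Ω δ γ)
    (hΛ : ∀ x ∈ S, ∫⁻ y in fullDomain Ω δ, ENNReal.ofReal (γ x y ^ 2) ≤ ENNReal.ofReal (Λ ^ 2))
    {e : E d → ℝ} (he : Measurable e) (he2 : MemLp e 2 (volume.restrict (fullDomain Ω δ)))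
    (heS : ∀ x, x ∉ S → e x = 0)
    (hres : ∀ᵐ x ∂volume.restrict (fullDomain Ω δ), x ∈ Ω →
      |2 * ∫ y in fullDomain Ω δ, (e y - e x) * γ x y| ≤ η)
    (hflux : ∀ᵐ x ∂volume.restrict (fullDomain Ω δ), x ∈ S → x ∉ Ω →
      ∫ y in fullDomain Ω δ, (e y - e x) * γ x y = 0)
    (hpoincare : ∫⁻ x in Ω, ENNReal.ofReal (e x ^ 2) ≤
      ENNReal.ofReal c * energy γ (fullDomain Ω δ) e) :
    energy γ (fullDomain Ω δ) e ≤ ENNReal.ofReal (V * c * η ^ 2) := by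
  have := isFiniteMeasure_restrict_fullDomain hΩ_bdd hδ
  have hΩm := hΩ_open.measurableSet
  set μ := volume.restrict (fullDomain Ω δ) with hμ
  have hes : Integrable (fun x => e x ^ 2) μ := he2.integrable_sq
  -- Young's inequality with weight `c`, the Poincaré constant: the quadratic term then integrates
  -- to at most half the energy.
  set f : E d → ℝ := fun x => c * η ^ 2 / 2 + Ω.indicator (fun x => e x ^ 2 / (2 * c)) x with hf
  have hfi : Integrable (fun x => Ω.indicator (fun x => e x ^ 2 / (2 * c)) x) μ :=
    (hes.div_const _).indicator hΩm
  have hEle : energy γ (fullDomain Ω δ) e ≤ ENNReal.ofReal (∫ x, f x ∂μ) := by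
    refine lintegral_energy_le_of_ae_bound hγ.measurable hγ.nonneg hγ.symm hΛ he he2 heS
      ((integrable_const _).add hfi) ?_
    filter_upwards [hres, hflux] with x h1 h2
    by_cases hxΩ : x ∈ Ω
    · simp only [hf, indicator_of_mem hxΩ]
      calc |e x| * |2 * ∫ y, (e y - e x) * γ x y ∂μ| ≤ |e x| * η := by
            gcongr; exact h1 hxΩ
        _ ≤ c * η ^ 2 / 2 + e x ^ 2 / (2 * c) := by
            rw [← sq_abs (e x)]
            have h : c * η ^ 2 / 2 + |e x| ^ 2 / (2 * c) - |e x| * η =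
                (|e x| - c * η) ^ 2 / (2 * c) := by field_simp; ring
            have h' : 0 ≤ (|e x| - c * η) ^ 2 / (2 * c) := by positivity
            linarith
    · have h0 : |e x| * |2 * ∫ y, (e y - e x) * γ x y ∂μ| = 0 := by
        by_cases hxS : x ∈ S
        · rw [h2 hxS hxΩ]; simp
        · rw [heS x hxS]; simp
      rw [h0]
      simp only [hf, indicator_of_notMem hxΩ]
      positivity
  -- Subtracting half the energy from both sides requires it to be finite; integrability of `f`
  -- provides this.
  have hEtop : energy γ (fullDomain Ω δ) e ≠ ∞ := (hEle.trans_lt ENNReal.ofReal_lt_top).ne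
  set X := (energy γ (fullDomain Ω δ) e).toReal with hX
  have hmass : ∫ x in Ω, e x ^ 2 ≤ c * X := by
    rw [integral_eq_lintegral_of_nonneg_ae (Eventually.of_forall fun _ => sq_nonneg _)
      (by fun_prop), hX, ← ENNReal.toReal_ofReal hc.le, ← ENNReal.toReal_mul]
    exact ENNReal.toReal_mono (ENNReal.mul_ne_top ENNReal.ofReal_ne_top hEtop) hpoincare
  have h_inner : ∫ x, f x ∂μ ≤ V * (c * η ^ 2 / 2) + X / 2 := by
    rw [hf, integral_add (integrable_const _) hfi, integral_const, smul_eq_mul,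
      integral_indicator hΩm, hμ, Measure.restrict_restrict hΩm,
      inter_eq_self_of_subset_left subset_fullDomain, integral_div,
      measureReal_restrict_apply_univ]
    have h1 : volume.real (fullDomain Ω δ) * (c * η ^ 2 / 2) ≤ V * (c * η ^ 2 / 2) := by
      gcongr
      exact hV
    have h2 : (∫ x in Ω, e x ^ 2) / (2 * c) ≤ X / 2 := by
      rw [div_le_div_iff₀ (by positivity) two_pos]
      nlinarith
    exact add_le_add h1 h2
  have hV0 : 0 ≤ V := ENNReal.toReal_nonneg.trans hV
  have hXle : X ≤ V * (c * η ^ 2 / 2) + X / 2 := by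
    have := ENNReal.toReal_mono ENNReal.ofReal_ne_top hEle
    rw [ENNReal.toReal_ofReal'] at this
    refine this.trans (max_le h_inner ?_)
    have : 0 ≤ X := ENNReal.toReal_nonneg
    positivity
  rw [← ENNReal.ofReal_toReal hEtop]
  exact ENNReal.ofReal_le_ofReal (by rw [← hX]; linarith)

/-- Dirichlet-to-Neumann coupling. -/
theorem dirichletToNeumann_energy_error
    {Ω : Set (E d)} (hΩ_open : IsOpen Ω) (hΩ_conn : IsConnected Ω)
    (hΩ_bdd : Bornology.IsBounded Ω) (hΩ_lip : HasLipschitzBoundary Ω)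
    {δ₀ : ℝ} (hδ₀ : 0 < δ₀) {γ : ℝ → E d → E d → ℝ}
    (hγ : ∀ δ ∈ Ioc 0 δ₀, IsIntegrableKernel Ω δ (γ δ))
    (hγ_scale : ProperlyScaled Ω δ₀ γ)
    {Ωloc Ωnloc : ℝ → Set (E d)}
    (hsplit : ∀ δ ∈ Ioc 0 δ₀, IsSplitting Ω δ (Ωloc δ) (Ωnloc δ))
    {s v ul : ℝ → E d → ℝ}
    (hcd : ∀ δ ∈ Ioc 0 δ₀, ContDiffOn ℝ 4 (ul δ) (fullDomain Ω δ))
    (hpoisson : ∀ δ ∈ Ioc 0 δ₀, ∀ x ∈ fullDomain Ω δ, -(Laplacian.laplacian (ul δ) x) = s δ x)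
    (hul_C4 : UniformlyC4 Ω δ₀ ul)
    (hcompat : ∀ δ ∈ Ioc 0 δ₀, ∀ᵐ x ∂volume.restrict (Ωnloc δ), v δ x = ul δ x)
    (hloc : ∀ δ ∈ Ioc 0 δ₀, IntegrableAtLoc Ω δ (Ωloc δ) (γ δ))
    (hdom : DominatesRadial Ω δ₀ γ) (hport : ContainsBoundaryPortion Ω δ₀ Ωnloc) :
    ∃ C : ℝ, ∀ᶠ δ in 𝓝[>] (0 : ℝ), ∀ un : E d → ℝ,
      IsDtNSolution Ω δ (Ωloc δ) (Ωnloc δ) (γ δ) (s δ) (v δ) (ul δ) un →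
      energySeminorm (γ δ) (fullDomain Ω δ) (un - ul δ) ≤ ENNReal.ofReal (C * δ ^ 2) := by
  obtain ⟨C, hC, hcons⟩ := exists_consistency_bound hΩ_bdd hγ hγ_scale hcd hpoisson hul_C4
  obtain ⟨M, hM⟩ := hul_C4
  obtain ⟨P, hP, hpoin⟩ :=
    energyControls_domain hδ₀ hdom hΩ_open hΩ_conn hΩ_bdd hΩ_lip hport
  set V : ℝ := (volume (Metric.thickening 1 Ω)).toReal with hV
  have hV0 : 0 ≤ V := ENNReal.toReal_nonneg
  set c : ℝ := P.toReal + 1 with hc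
  have hc0 : 0 < c := by positivity
  have hPc : P ≤ ENNReal.ofReal c := by
    rw [← ENNReal.ofReal_toReal hP]
    exact ENNReal.ofReal_le_ofReal (by linarith)
  refine ⟨C * √(V * c), ?_⟩
  filter_upwards [exists_small_horizon 0 hδ₀, hpoin] with δ ⟨hδ, hδ1, _⟩ hpδ un hun
  have := isFiniteMeasure_restrict_fullDomain hΩ_bdd hδ.1
  have hk := hγ δ hδ
  have hsp := hsplit δ hδ
  have hUm := measurableSet_fullDomain (Ω := Ω) hδ.1
  have hU1 := fullDomain_subset_thickening_one (Ω := Ω) hδ.1 hδ1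
  have hul2 : MemLp (ul δ) 2 (volume.restrict (fullDomain Ω δ)) :=
    memLp_two_of_uniformlyC4 hΩ_bdd hδ.1 (hcd δ hδ).continuousOn (hM δ hδ 0 (by norm_num))
  have hZ : ∀ᵐ x ∂volume.restrict (Ωnloc δ), un x = ul δ x := by
    filter_upwards [hun.eq_nloc, hcompat δ hδ] with x h1 h2 using h1.trans h2
  obtain ⟨e, hem, he2, hee, he0⟩ :=
    exists_error_representative hUm hsp.measurableSet_nloc hun.mem.1 hul2 hZ
  have heS : ∀ x, x ∉ Ω ∪ Ωloc δ → e x = 0 := fun x hx => he0 x fun ⟨h1, h2⟩ => by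
    rcases h1 with h | h
    · exact hx (Or.inl h)
    · rw [← hsp.union_eq] at h
      exact h.elim (fun h => hx (Or.inr h)) h2
  obtain ⟨Λ₁, hΛ₁0, hΛ₁⟩ := hk.upper
  obtain ⟨Λ₂, hΛ₂0, hΛ₂⟩ := hloc δ hδ
  have hΛ : ∀ x ∈ Ω ∪ Ωloc δ, ∫⁻ y in fullDomain Ω δ, ENNReal.ofReal (γ δ x y ^ 2) ≤
      ENNReal.ofReal ((max Λ₁ Λ₂) ^ 2) := by
    rintro x (hx | hx)
    · refine (hΛ₁ x hx).trans (ENNReal.ofReal_le_ofReal ?_)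
      gcongr; exact le_max_left _ _
    · refine (hΛ₂ x hx).trans (ENNReal.ofReal_le_ofReal ?_)
      gcongr; exact le_max_right _ _
  have hres := ae_abs_residual_le hΩ_open hΩ_bdd hδ.1 hk (hcons δ hδ hδ1) hun.mem.1 hul2
    hun.poisson hee
  -- On `Ω_loc` the two fluxes agree, so the inner integral for `e` vanishes and the Green identity
  -- only sees `Ω`.
  have hflux : ∀ᵐ x ∂volume.restrict (fullDomain Ω δ), x ∈ Ω ∪ Ωloc δ → x ∉ Ω →
      ∫ y in fullDomain Ω δ, (e y - e x) * γ δ x y = 0 := by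
    have h := hun.flux_loc
    rw [ae_restrict_iff' hsp.measurableSet_loc] at h
    filter_upwards [hee, ae_restrict_of_ae h] with x hx hfl hxS hxΩ
    have hxl : x ∈ Ωloc δ := hxS.resolve_left hxΩ
    rw [integral_kernel_sub_of_ae_eq hun.mem.1 hul2 (memLp_two_of_lintegral_sq_le
      (hk.measurable.of_uncurry_left (x := x)) (hΛ₂ x hxl)) hee hx]
    have := hfl hxl
    simp only [nonlocalFlux, neg_neg] at this
    rw [this, sub_self]
  rw [energySeminorm_congr_ae hee]
  refine energySeminorm_le_of_lintegral_le (by positivity) ?_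
  have hVle : (volume (fullDomain Ω δ)).toReal ≤ V :=
    ENNReal.toReal_mono (volume_thickening_one_lt_top hΩ_bdd).ne (measure_mono hU1)
  refine (energy_le_of_residual_le hΩ_open hΩ_bdd hδ.1 hc0 hVle hk hΛ hem he2 heS hres hflux
    ((hpδ e hem fun x hx => he0 x fun h => h.2 hx).trans (by gcongr))).trans (le_of_eq ?_)
  congr 1
  rw [mul_pow (C * √(V * c)), mul_pow C √(V * c), Real.sq_sqrt (by positivity)]
  ring

end NonlocalPoisson

end

theorem theorem4p1 {d : ℕ} (hd : 0 < d)
    (Ω : Set (NonlocalPoisson.E d)) (hΩ_open : IsOpen Ω) (hΩ_conn : IsConnected Ω)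
    (hΩ_bdd : Bornology.IsBounded Ω) (hΩ_lip : NonlocalPoisson.HasLipschitzBoundary Ω)
    (δ₀ : ℝ) (hδ₀ : 0 < δ₀)
    (γ : ℝ → NonlocalPoisson.E d → NonlocalPoisson.E d → ℝ)
    (hγ : ∀ δ ∈ Ioc 0 δ₀, NonlocalPoisson.IsIntegrableKernel Ω δ (γ δ))
    (hγ_scale : NonlocalPoisson.ProperlyScaled Ω δ₀ γ)
    (Ωloc Ωnloc : ℝ → Set (NonlocalPoisson.E d))
    (hsplit : ∀ δ ∈ Ioc 0 δ₀, NonlocalPoisson.IsSplitting Ω δ (Ωloc δ) (Ωnloc δ))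
    (s w v ul : ℝ → NonlocalPoisson.E d → ℝ)
    (hul : ∀ δ ∈ Ioc 0 δ₀,
      NonlocalPoisson.IsLocalSolution Ω δ (Ωloc δ) (Ωnloc δ) (s δ) (w δ) (v δ) (ul δ))
    (hul_C4 : NonlocalPoisson.UniformlyC4 Ω δ₀ ul)
    (hcompat : ∀ δ ∈ Ioc 0 δ₀, ∀ᵐ x ∂volume.restrict (Ωnloc δ), v δ x = ul δ x) :
    (∃ C : ℝ, ∀ᶠ δ in 𝓝[>] (0 : ℝ), ∀ un : NonlocalPoisson.E d → ℝ,
      NonlocalPoisson.IsDtDSolution Ω δ (Ωloc δ) (Ωnloc δ) (γ δ) (s δ) (v δ) (ul δ) un →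
      NonlocalPoisson.energySeminorm (γ δ) (NonlocalPoisson.fullDomain Ω δ) (un - ul δ) ≤
        ENNReal.ofReal (C * δ ^ 2)) ∧
    ((∀ δ ∈ Ioc 0 δ₀, NonlocalPoisson.IntegrableAtLoc Ω δ (Ωloc δ) (γ δ)) →
      NonlocalPoisson.DominatesRadial Ω δ₀ γ →
      NonlocalPoisson.ContainsBoundaryPortion Ω δ₀ Ωnloc →
      ∃ C : ℝ, ∀ᶠ δ in 𝓝[>] (0 : ℝ), ∀ un : NonlocalPoisson.E d → ℝ,
        NonlocalPoisson.IsDtNSolution Ω δ (Ωloc δ) (Ωnloc δ) (γ δ) (s δ) (v δ) (ul δ) un →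
        NonlocalPoisson.energySeminorm (γ δ) (NonlocalPoisson.fullDomain Ω δ) (un - ul δ) ≤
          ENNReal.ofReal (C * δ ^ 2)) := by
  exact ⟨NonlocalPoisson.dirichletToDirichlet_energy_error hd hΩ_open hΩ_bdd hδ₀ hγ hγ_scale hsplit
      (fun δ hδ => (hul δ hδ).contDiffOn) (fun δ hδ => (hul δ hδ).poisson) hul_C4 hcompat,
    fun hloc hdom hport => NonlocalPoisson.dirichletToNeumann_energy_error hΩ_open hΩ_conn hΩ_bdd
      hΩ_lip hδ₀ hγ hγ_scale hsplit (fun δ hδ => (hul δ hδ).contDiffOn)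
      (fun δ hδ => (hul δ hδ).poisson) hul_C4 hcompat hloc hdom hport⟩
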